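/- Let $M\in\mathbb Q^{3\times 3}$ be a matrix whose eigenvalues, with multiplicity, are $\lambda,\overline\lambda,\rho$ with $\lambda\in\mathbb C\setminus\mathbb R$ and $\rho\in\mathbb R$, and suppose that $\gamma=\lambda/|\lambda|$ is a root of unity. Let $s\in\mathbb Q^3$, let $p\in\mathbb Z[x_1,x_2,x_3]$, and let $T\subseteq\mathbb R^3$ be the atomic semialgebraic set $\{x: p(x)>0\}$ or $\{x: p(x)\ge 0\}$. Write $\|\mathcal I_T\|=\|M\|+\|s\|+\|p\|$, where $\|\cdot\|$ is the bit length; integers are written in binary, rationals as fractions in lowest terms, and $p$ as the list of all coefficients of $x_1^ix_2^jx_3^k$ with $0\le i,j,k\le\deg p$, zeros included. Then there are an integer $N=2^{\|\mathcal I_T\|^{O(1)}}$ and a set $X\subseteq\{0,1,\dots,287\}$ such that, for all $n>N$, $M^ns\in T$ if and only if $n\bmod 288\in X$. Here the constant in $O(1)$ is absolute, and $X$ is computable: a single algorithm, given $M$, $s$, $p$ and the kind of inequality ($>$ or $\ge$), outputs the list of elements of $X$. -/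

import Mathlib

/-- Bit length of an integer in binary: one sign bit and the binary digits of its absolute value. -/
def intBits (z : ℤ) : ℕ := z.natAbs.size + 1

/-- Bit length of a rational number, written in lowest terms. -/
def ratBits (q : ℚ) : ℕ := intBits q.num + q.den.size

/-- Bit length of a rational `3 × 3` matrix. -/
def matrixBits (M : Matrix (Fin 3) (Fin 3) ℚ) : ℕ := ∑ i, ∑ j, ratBits (M i j)

/-- Bit length of a rational vector with three entries. -/
def vectorBits (s : Fin 3 → ℚ) : ℕ := ∑ i, ratBits (s i)

/-- The coefficient of `x₀ ^ i * x₁ ^ j * x₂ ^ k` in `p`. -/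
noncomputable def coeff3 (p : MvPolynomial (Fin 3) ℤ) (i j k : ℕ) : ℤ :=
  p.coeff (Finsupp.equivFunOnFinite.symm ![i, j, k])

/-- The dense list of coefficients of `p`, zeros included: the coefficients of all monomials
`x₀ ^ i * x₁ ^ j * x₂ ^ k` with `0 ≤ i, j, k ≤ deg p`, in lexicographic order of `(i, j, k)`. -/
noncomputable def coeffList (p : MvPolynomial (Fin 3) ℤ) : List ℤ :=
  (List.range (p.totalDegree + 1)).flatMap fun i =>
    (List.range (p.totalDegree + 1)).flatMap fun j =>
      (List.range (p.totalDegree + 1)).map fun k => coeff3 p i j k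

/-- Bit length of a polynomial, as its dense list of coefficients in binary. -/
noncomputable def polyBits (p : MvPolynomial (Fin 3) ℤ) : ℕ := ((coeffList p).map intBits).sum

/-- The size of an instance: the bit lengths of the matrix, the starting point and the polynomial
together. -/
noncomputable def instanceSize (M : Matrix (Fin 3) (Fin 3) ℚ) (s : Fin 3 → ℚ)
    (p : MvPolynomial (Fin 3) ℤ) : ℕ := matrixBits M + vectorBits s + polyBits p

/-- The atomic semialgebraic subset of `ℝ³` defined by `p > 0` (if `strict` is true) or by
`p ≥ 0` (if `strict` is false). -/
def atomicSet (p : MvPolynomial (Fin 3) ℤ) (strict : Bool) : Set (Fin 3 → ℝ) :=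
  if strict then {x | 0 < MvPolynomial.aeval x p} else {x | 0 ≤ MvPolynomial.aeval x p}

/-- A rational number as the pair of its numerator and its denominator. -/
def ratCode (q : ℚ) : ℤ × ℕ := (q.num, q.den)

/-- The finite data from which algorithms start: the entries of the matrix row by row, the entries
of the starting point, the degree and the dense coefficient list of the polynomial, and the kind
of the inequality. -/
abbrev InstanceCode : Type :=
  List (ℤ × ℕ) × List (ℤ × ℕ) × (ℕ × List ℤ) × Bool

/-- The data that represent the instance given by `M`, `s` and the inequality `p > 0` or
`p ≥ 0`. -/
noncomputable def instanceCode (M : Matrix (Fin 3) (Fin 3) ℚ) (s : Fin 3 → ℚ)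
    (p : MvPolynomial (Fin 3) ℤ) (strict : Bool) : InstanceCode :=
  ((List.finRange 3).flatMap fun i => (List.finRange 3).map fun j => ratCode (M i j),
    (List.finRange 3).map fun i => ratCode (s i),
    (p.totalDegree, coeffList p),
    strict)

/-! If `γ ^ d = 1`, then `λ ^ d` is real, so it equals the `d`-th power of the conjugate of `λ`. The
rational power sums of the eigenvalues with exponents `d`, `2d`, `3d` then force `λ ^ d` and `ρ ^ d`
to be rational. If `ρ` is rational, the quotient of `λ` and its conjugate is a root of unity of
degree at most two over ℚ, and its order divides 12. If `ρ` is irrational, the characteristic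
polynomial turns out to be `X ^ 3 - c`. In both cases `λ` and its conjugate have the same twelfth
power (`pow_twelve_eq_of_pow_eq`), and `λ ^ 288` and `ρ ^ 288` are nonnegative rationals
(`exists_rat_pow_288`).

Let `D` clear the denominators and `A = D * M`. Then `A ^ 288` is diagonalisable over ℚ with natural
eigenvalues `L`, `R`, so `e • A ^ (288 * m) = L ^ m • P + R ^ m • Q` with integral data of
polynomial bit length (`exists_pow_decomposition`). Along a residue class modulo 288, the orbit, and
hence the homogenised polynomial on it, is an integral combination of `m`-th powers of natural
numbers. The largest base whose coefficient survives decides the sign as soon as `m` exceeds the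
product of a bound for the bases and a bound for the coefficients (`IsExpSum.sign_eq`). Both bounds
are exponential in a polynomial of the size, which gives `N`.

As the threshold is explicit, one exact evaluation beyond it in each class determines `X`, and this
procedure is primitive recursive (`InstanceCode.primrec_residues`). -/

/-! ### Rationality of powers of the eigenvalues. -/

theorem exists_rat_powerSum {x y z : ℂ} {a b c : ℚ} (ha : x + y + z = a)
    (hb : x * y + y * z + z * x = b) (hc : x * y * z = c) (k : ℕ) :
    ∃ q : ℚ, x ^ k + y ^ k + z ^ k = q := by
  induction k using Nat.strong_induction_on with
  | _ k ih =>
    match k with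
    | 0 => exact ⟨3, by norm_num⟩
    | 1 => exact ⟨a, by simpa using ha⟩
    | 2 => exact ⟨a ^ 2 - 2 * b, by push_cast; rw [← ha, ← hb]; ring⟩
    | k + 3 =>
      obtain ⟨q₀, h₀⟩ := ih k (by omega)
      obtain ⟨q₁, h₁⟩ := ih (k + 1) (by omega)
      obtain ⟨q₂, h₂⟩ := ih (k + 2) (by omega)
      refine ⟨a * q₂ - b * q₁ + c * q₀, ?_⟩
      push_cast
      rw [← h₀, ← h₁, ← h₂, ← ha, ← hb, ← hc]
      ring

/-- With `δ = u - v`, the second power sum determines `δ ^ 2` and the third one then determines `δ ^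
3`, both rationally in the data. Hence `δ = δ ^ 3 / δ ^ 2` is rational, and `δ` and `a` determine
`u` and `v`. -/
theorem exists_rat_of_double_powerSums {u v : ℂ} {a b c : ℚ} (ha : 2 * u + v = a)
    (hb : 2 * u ^ 2 + v ^ 2 = b) (hc : 2 * u ^ 3 + v ^ 3 = c) :
    ∃ q r : ℚ, u = q ∧ v = r := by
  suffices h : ∃ δ : ℚ, u - v = δ by
    obtain ⟨δ, h⟩ := h
    refine ⟨(a + δ) / 3, (a - 2 * δ) / 3, ?_, ?_⟩ <;> push_cast <;> rw [← ha, ← h] <;> ring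
  by_cases huv : u = v
  · exact ⟨0, by simp [huv]⟩
  have hne : u - v ≠ 0 := sub_ne_zero.mpr huv
  have h2 : (u - v) ^ 2 = (((3 * b - a ^ 2) / 2 : ℚ) : ℂ) := by
    push_cast; rw [← ha, ← hb]; ring
  have h3 : (u - v) ^ 3 = (((3 * a ^ 3 + 18 * a * ((3 * b - a ^ 2) / 2) - 27 * c) / 6 : ℚ) : ℂ) := by
    push_cast; rw [← ha, ← hb, ← hc]; ring
  refine ⟨((3 * a ^ 3 + 18 * a * ((3 * b - a ^ 2) / 2) - 27 * c) / 6) / ((3 * b - a ^ 2) / 2), ?_⟩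
  rw [Rat.cast_div, ← h2, ← h3]
  field_simp

theorem exists_rat_pow_of_pow_eq {x y z : ℂ} {a b c : ℚ} (ha : x + y + z = a)
    (hb : x * y + y * z + z * x = b) (hc : x * y * z = c) {d : ℕ} (h : x ^ d = y ^ d) :
    ∃ u v : ℚ, x ^ d = u ∧ z ^ d = v := by
  have hps := exists_rat_powerSum ha hb hc
  obtain ⟨t₁, h₁⟩ := hps d
  obtain ⟨t₂, h₂⟩ := hps (2 * d)
  obtain ⟨t₃, h₃⟩ := hps (3 * d)
  exact exists_rat_of_double_powerSums (u := x ^ d) (v := z ^ d)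
    (a := t₁) (b := t₂) (c := t₃) (by rw [← h₁, ← h]; ring)
    (by rw [← h₂, pow_mul', pow_mul', pow_mul', ← h]; ring)
    (by rw [← h₃, pow_mul', pow_mul', pow_mul', ← h]; ring)

theorem Int.exists_of_isIntegral_ratCast {q : ℚ} (h : IsIntegral ℤ (q : ℂ)) : ∃ k : ℤ, q = k := by
  have h' : IsIntegral ℤ q :=
    (isIntegral_algebraMap_iff (algebraMap ℚ ℂ).injective).mp (by simpa using h)
  obtain ⟨k, hk⟩ := IsIntegrallyClosed.isIntegral_iff.mp h'
  exact ⟨k, by simpa using hk.symm⟩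

/-- A root of unity of degree at most two over the rationals has order dividing twelve. -/
theorem pow_twelve_eq_one_of_add_inv_rat {ζ : ℂ} {d : ℕ} (hd : 0 < d) (hζ : ζ ^ d = 1) {q : ℚ}
    (hq : ζ + ζ⁻¹ = q) : ζ ^ 12 = 1 := by
  have hint : ∀ w : ℂ, w ^ d = 1 → IsIntegral ℤ w := fun w hw =>
    IsIntegral.of_pow hd (by rw [hw]; exact isIntegral_one)
  have hnorm : ‖ζ‖ = 1 := Complex.norm_eq_one_of_pow_eq_one hζ hd.ne'
  have hζ0 : ζ ≠ 0 := by rintro rfl; simp at hnorm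
  -- `ζ + ζ⁻¹` is a rational algebraic integer, hence an integer, of absolute value at most 2.
  obtain ⟨k, rfl⟩ := Int.exists_of_isIntegral_ratCast (q := q)
    (hq ▸ (hint ζ hζ).add (hint ζ⁻¹ (by rw [inv_pow, hζ, inv_one])))
  have hk : |k| ≤ 2 := by
    have h1 : ‖((k : ℚ) : ℂ)‖ ≤ 2 := by
      rw [← hq]
      refine (norm_add_le _ _).trans ?_
      rw [norm_inv, hnorm]; norm_num
    have h2 : ‖((k : ℚ) : ℂ)‖ = ((|k| : ℤ) : ℝ) := by
      rw [Rat.cast_intCast, Complex.norm_intCast]; push_cast; rfl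
    rw [h2] at h1
    exact_mod_cast h1
  have hquad : ζ ^ 2 + 1 = k * ζ := by
    have : ζ * (ζ + ζ⁻¹) = ζ * k := by rw [hq]; simp
    rw [mul_add, mul_inv_cancel₀ hζ0] at this
    linear_combination this
  obtain ⟨h1, h2⟩ := abs_le.mp hk
  -- The values -2, -1, 0, 1, 2 belong to the orders 2, 3, 4, 6, 1.
  interval_cases k
  · have : (ζ + 1) ^ 2 = 0 := by push_cast at hquad; linear_combination hquad
    have : ζ = -1 := eq_neg_of_add_eq_zero_left (pow_eq_zero_iff two_ne_zero |>.mp this)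
    rw [this]; norm_num
  · have : ζ ^ 3 = 1 := by push_cast at hquad; linear_combination (ζ - 1) * hquad
    rw [show (12 : ℕ) = 3 * 4 from rfl, pow_mul, this, one_pow]
  · have : ζ ^ 2 = -1 := by push_cast at hquad; linear_combination hquad
    rw [show (12 : ℕ) = 2 * 6 from rfl, pow_mul, this]; norm_num
  · have : ζ ^ 3 = -1 := by push_cast at hquad; linear_combination (ζ + 1) * hquad
    rw [show (12 : ℕ) = 3 * 4 from rfl, pow_mul, this]; norm_num
  · have : (ζ - 1) ^ 2 = 0 := by push_cast at hquad; linear_combination hquad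
    have : ζ = 1 := sub_eq_zero.mp (pow_eq_zero_iff two_ne_zero |>.mp this)
    rw [this]; norm_num

/-- If two roots of a rational cubic have a quotient that is a root of unity, then their
twelfth powers agree. -/
theorem pow_twelve_eq_of_pow_eq {x y z : ℂ} {a b c : ℚ} (ha : x + y + z = a)
    (hb : x * y + y * z + z * x = b) (hc : x * y * z = c) (hx : x ≠ 0) (hy : y ≠ 0)
    (hxy : x * y = (‖x‖ ^ 2 : ℝ)) {r : ℝ} (hr : z = r)
    {d : ℕ} (hd : 0 < d) (h : x ^ d = y ^ d) : x ^ 12 = y ^ 12 := by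
  have rational_case : ∀ q : ℚ, z = q → x ^ 12 = y ^ 12 := by
    intro q hq
    have hζ : (x / y) ^ 12 = 1 := by
      refine pow_twelve_eq_one_of_add_inv_rat (q := ((a - q) ^ 2 - 2 * (b - (a - q) * q)) /
        (b - (a - q) * q)) hd (by rw [div_pow, h, div_self (pow_ne_zero _ hy)]) ?_
      have h1 : x + y = ((a - q : ℚ) : ℂ) := by push_cast; rw [← ha, ← hq]; ring
      have h2 : x * y = ((b - (a - q) * q : ℚ) : ℂ) := by
        rw [Rat.cast_sub, Rat.cast_mul, ← h1, ← hq, ← hb]; ring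
      rw [Rat.cast_div, Rat.cast_sub, Rat.cast_pow, ← h1, Rat.cast_mul, ← h2]
      push_cast
      field_simp
      ring
    rwa [div_pow, div_eq_one_iff_eq (pow_ne_zero _ hy)] at hζ
  obtain ⟨t, ht⟩ := exists_rat_powerSum ha hb hc (d + 1)
  obtain ⟨u, v, hu, hv⟩ := exists_rat_pow_of_pow_eq ha hb hc h
  -- The power sum with exponent `d + 1` is `u * (a - z) + v * z`, which makes `z` rational unless
  -- `u = v`. In that exceptional case `|x| = |z|`, so `z ^ 3 = x * y * z = c`.
  by_cases huv : u = v
  · have hcub : ∀ w : ℂ, (w - x) * (w - y) * (w - z) = w ^ 3 - a * w ^ 2 + b * w - c := by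
      intro w; rw [← ha, ← hb, ← hc]; ring
    by_cases hz : ∃ q' : ℚ, z = q'
    · obtain ⟨q', hq'⟩ := hz
      exact rational_case q' hq'
    have hz0 : z ≠ 0 := fun h0 => hz ⟨0, by simpa using h0⟩
    have hzc' : z ^ 3 = c := by
      have hn : ‖x‖ = ‖z‖ := by
        have : ‖x‖ ^ d = ‖z‖ ^ d := by rw [← norm_pow, ← norm_pow, hu, hv, huv]
        exact (pow_left_inj₀ (norm_nonneg _) (norm_nonneg _) hd.ne').mp this
      rw [← hc, hxy, hn, hr, Complex.norm_real, Real.norm_eq_abs, sq_abs]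
      push_cast; ring
    -- Since `z` is a root of the cubic and `z ^ 3 = c`, only this linear relation is left. An
    -- irrational `z` satisfies it only for `a = b = 0`, so the cubic is `w ^ 3 - c`.
    have hab : (a : ℂ) * z = b := by
      have := hcub z
      rw [sub_self, mul_zero, hzc'] at this
      apply mul_right_cancel₀ hz0
      linear_combination this
    have ha0 : a = 0 := by
      by_contra ha0
      refine hz ⟨b / a, ?_⟩
      rw [Rat.cast_div, eq_div_iff (by exact_mod_cast ha0), mul_comm, hab]
    have hb0 : (b : ℂ) = 0 := by rw [← hab, ha0]; simp
    have hx3 : x ^ 3 = c := by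
      have := hcub x
      rw [ha0, hb0] at this
      push_cast at this
      linear_combination -this
    have hy3 : y ^ 3 = c := by
      have := hcub y
      rw [ha0, hb0] at this
      push_cast at this
      linear_combination -this
    rw [show (12 : ℕ) = 3 * 4 from rfl, pow_mul, pow_mul, hx3, hy3]
  · refine rational_case ((t - a * u) / (v - u)) ?_
    have hne : ((v : ℂ) - u) ≠ 0 := sub_ne_zero.mpr fun h' => huv (by exact_mod_cast h'.symm)
    push_cast
    rw [eq_div_iff hne, ← ht, ← ha, pow_succ, pow_succ, pow_succ, ← h, hu, hv]
    ring

/-- The power sums force `l ^ 288` and `ρ ^ 288` to be rational. -/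
theorem exists_rat_pow_288 {l : ℂ} {ρ : ℝ} {a b c : ℚ} (ha : l + (starRingEnd ℂ) l + ρ = a)
    (hb : l * (starRingEnd ℂ) l + (starRingEnd ℂ) l * ρ + ρ * l = b)
    (hc : l * (starRingEnd ℂ) l * ρ = c) (hl : l ≠ 0)
    {d : ℕ} (hd : 0 < d) (h : (l / (‖l‖ : ℂ)) ^ d = 1) :
    ((starRingEnd ℂ) l) ^ 288 = l ^ 288 ∧
      ∃ u v : ℚ, 0 ≤ u ∧ 0 ≤ v ∧ l ^ 288 = u ∧ (ρ : ℂ) ^ 288 = v := by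
  have hnl : (‖l‖ : ℂ) ≠ 0 := by simpa using hl
  have hpow : l ^ d = (‖l‖ : ℂ) ^ d := by
    rwa [div_pow, div_eq_one_iff_eq (pow_ne_zero _ hnl)] at h
  have hcl : (starRingEnd ℂ) l ^ d = (‖l‖ : ℂ) ^ d := by
    rw [← map_pow, hpow, map_pow, Complex.conj_ofReal]
  have h12 : l ^ 12 = (starRingEnd ℂ) l ^ 12 :=
    pow_twelve_eq_of_pow_eq ha hb hc hl (by simpa using hl)
      (by rw [Complex.mul_conj, Complex.normSq_eq_norm_sq]) rfl hd
      (by rw [hpow, hcl])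
  have h288 : ((starRingEnd ℂ) l) ^ 288 = l ^ 288 := by
    rw [show (288 : ℕ) = 12 * 24 from rfl, pow_mul, ← h12, ← pow_mul]
  refine ⟨h288, ?_⟩
  obtain ⟨u, v, hu, hv⟩ := exists_rat_pow_of_pow_eq ha hb hc h288.symm
  refine ⟨u, v, ?_, ?_, hu, hv⟩
  -- As 12 divides 144, one half of the factors of `l ^ 288` may be conjugated.
  · have hreal : l ^ 288 = (((‖l‖ ^ 2) ^ 144 : ℝ) : ℂ) := by
      have h144 : l ^ 144 = (starRingEnd ℂ) l ^ 144 := by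
        rw [show (144 : ℕ) = 12 * 12 from rfl, pow_mul, h12, ← pow_mul]
      push_cast
      rw [← Complex.mul_conj', mul_pow, ← h144, ← pow_add]
    rw [hu] at hreal
    have hreal' : (u : ℝ) = (‖l‖ ^ 2) ^ 144 := by exact_mod_cast hreal
    have : (0 : ℝ) ≤ u := by rw [hreal']; positivity
    exact_mod_cast this
  · have hreal' : (v : ℝ) = ρ ^ 288 := by exact_mod_cast hv.symm
    have : (0 : ℝ) ≤ v := by rw [hreal']; exact Even.pow_nonneg (by decide) ρ
    exact_mod_cast this

/-! ### Eigenvalues and powers of the integral matrix. -/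

open Polynomial in
theorem cubic_charpoly_facts {M : Matrix (Fin 3) (Fin 3) ℚ} {x y z : ℂ}
    (h : (M.map (fun q : ℚ => (q : ℂ))).charpoly.roots = {x, y, z}) :
    (M.map (fun q : ℚ => (q : ℂ))).charpoly = (X - C x) * (X - C y) * (X - C z) ∧
    ∃ a b c : ℚ, x + y + z = a ∧ x * y + y * z + z * x = b ∧ x * y * z = c := by
  have hprod : (M.map (fun q : ℚ => (q : ℂ))).charpoly = (X - C x) * (X - C y) * (X - C z) := by
    have hs := (IsAlgClosed.splits (M.map (fun q : ℚ => (q : ℂ))).charpoly).eq_prod_roots_of_monic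
      (Matrix.charpoly_monic _)
    rw [hs, h]
    simp [mul_assoc]
  refine ⟨hprod, ?_⟩
  have hexp : (X - C x) * (X - C y) * (X - C z) = X ^ 3 - C (x + y + z) * X ^ 2
      + C (x * y + y * z + z * x) * X - C (x * y * z) := by
    simp only [map_add, map_mul]; ring
  have hmap : (M.map (fun q : ℚ => (q : ℂ))).charpoly = M.charpoly.map (algebraMap ℚ ℂ) :=
    Matrix.charpoly_map M (algebraMap ℚ ℂ)
  have hcoeff : ∀ n, ((M.charpoly.coeff n : ℚ) : ℂ) = (X ^ 3 - C (x + y + z) * X ^ 2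
      + C (x * y + y * z + z * x) * X - C (x * y * z)).coeff n := by
    intro n
    rw [← hexp, ← hprod, hmap, coeff_map]; rfl
  refine ⟨-M.charpoly.coeff 2, M.charpoly.coeff 1, -M.charpoly.coeff 0, ?_, ?_, ?_⟩
  · push_cast; rw [hcoeff]; simp [-map_add, -map_mul]
  · rw [hcoeff]; simp [-map_add, -map_mul, coeff_C, coeff_X_pow]
  · push_cast; rw [hcoeff]; simp

theorem Matrix.exists_eigenvector_of_isRoot_charpoly {n : Type*} [Fintype n] [DecidableEq n]
    {K : Type*} [Field K] {A : Matrix n n K} {μ : K} (h : A.charpoly.IsRoot μ) :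
    ∃ v : n → K, v ≠ 0 ∧ A.mulVec v = μ • v := by
  rw [Polynomial.IsRoot.def, Matrix.eval_charpoly] at h
  obtain ⟨v, hv, h0⟩ := Matrix.exists_mulVec_eq_zero_iff.mpr h
  refine ⟨v, hv, ?_⟩
  rw [Matrix.sub_mulVec, sub_eq_zero] at h0
  rw [← h0]
  ext i
  simp [Matrix.scalar_apply, Matrix.mulVec_diagonal]

theorem Matrix.isRoot_charpoly_of_mulVec_eq_smul {n : Type*} [Fintype n] [DecidableEq n]
    {K : Type*} [Field K] {A : Matrix n n K} {μ : K} {v : n → K} (hv : v ≠ 0)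
    (h : A.mulVec v = μ • v) : A.charpoly.IsRoot μ := by
  rw [Polynomial.IsRoot.def, Matrix.eval_charpoly]
  refine Matrix.exists_mulVec_eq_zero_iff.mp ⟨v, hv, ?_⟩
  rw [Matrix.sub_mulVec, h, sub_eq_zero]
  ext i
  simp [Matrix.scalar_apply, Matrix.mulVec_diagonal]

theorem Matrix.isIntegral_of_mulVec_eq_smul {n : Type*} [Fintype n] [DecidableEq n]
    {A : Matrix n n ℤ} {μ : ℂ} {v : n → ℂ} (hv : v ≠ 0)
    (h : (A.map (fun z : ℤ => (z : ℂ))).mulVec v = μ • v) : IsIntegral ℤ μ := by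
  have hr := Matrix.isRoot_charpoly_of_mulVec_eq_smul hv h
  have hmap : (A.map (fun z : ℤ => (z : ℂ))).charpoly = A.charpoly.map (algebraMap ℤ ℂ) :=
    Matrix.charpoly_map A (algebraMap ℤ ℂ)
  refine ⟨A.charpoly, Matrix.charpoly_monic A, ?_⟩
  rwa [hmap, Polynomial.IsRoot.def, Polynomial.eval_map] at hr

/-- Compare both sides of the eigenvector equation in a coordinate where `v` has the largest
modulus. -/
theorem Matrix.norm_le_of_mulVec_eq_smul {n : Type*} [Fintype n] {A : Matrix n n ℂ} {μ : ℂ}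
    {v : n → ℂ} (hv : v ≠ 0) (h : A.mulVec v = μ • v) {W : ℝ} (hW : ∀ i j, ‖A i j‖ ≤ W) :
    ‖μ‖ ≤ Fintype.card n * W := by
  obtain ⟨k, hk⟩ := Function.ne_iff.mp hv
  have : Nonempty n := ⟨k⟩
  obtain ⟨i, hi⟩ := Finite.exists_max fun i => ‖v i‖
  have hpos : 0 < ‖v i‖ := (norm_pos_iff.mpr hk).trans_le (hi k)
  refine le_of_mul_le_mul_right ?_ hpos
  calc ‖μ‖ * ‖v i‖ = ‖∑ j, A i j * v j‖ := by
        rw [← norm_mul]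
        exact congrArg norm (congrFun h i).symm
    _ ≤ ∑ j, W * ‖v i‖ := by
        refine (norm_sum_le _ _).trans (Finset.sum_le_sum fun j _ => ?_)
        rw [norm_mul]
        exact mul_le_mul (hW i j) (hi j) (norm_nonneg _) ((norm_nonneg _).trans (hW i j))
    _ = Fintype.card n * W * ‖v i‖ := by
        rw [Finset.sum_const, Finset.card_univ, nsmul_eq_mul, mul_assoc]

open Polynomial in
/-- A power of a matrix with simple conjugate roots is annihilated by the powers of the roots. -/
theorem pow_annihilated {n : Type*} [Fintype n] [DecidableEq n] {A : Matrix n n ℂ} {x y z : ℂ}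
    (hA : A.charpoly = (X - C x) * (X - C y) * (X - C z)) (hxy : x ≠ y) (hxz : x ≠ z)
    (hyz : y ≠ z) {k : ℕ} {L R : ℂ} (hx : x ^ k = L) (hy : y ^ k = L) (hz : z ^ k = R) :
    (A ^ k - algebraMap ℂ _ L) * (A ^ k - algebraMap ℂ _ R) = 0 ∧
      (L = R → A ^ k = algebraMap ℂ _ L) := by
  have hroot : ∀ w U : ℂ, w ^ k = U → X - C w ∣ (X ^ k - C U : ℂ[X]) := by
    intro w U h
    rw [dvd_iff_isRoot]; simp [h]
  have hco : ∀ w w' : ℂ, w ≠ w' → IsCoprime (X - C w) (X - C w') := fun w w' h =>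
    isCoprime_X_sub_C_of_isUnit_sub (sub_ne_zero.mpr h).isUnit
  have h2 : (X - C x) * (X - C y) ∣ (X ^ k - C L : ℂ[X]) :=
    (hco x y hxy).mul_dvd (hroot x L hx) (hroot y L hy)
  have haeval : ∀ q : ℂ[X], A.charpoly ∣ q → aeval A q = 0 := by
    rintro q ⟨r, rfl⟩
    rw [map_mul, Matrix.aeval_self_charpoly, zero_mul]
  constructor
  · have := haeval ((X ^ k - C L) * (X ^ k - C R)) (by
      rw [hA]; exact mul_dvd_mul h2 (hroot z R hz))
    simpa using this
  -- If the two values coincide, all three distinct roots are roots of `X ^ k - L`, so this single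
  -- factor already annihilates `A`.
  · intro hLR
    have := haeval (X ^ k - C L) (by
      rw [hA]
      exact (((hco x z hxz).mul_left (hco y z hyz)).mul_dvd h2 (hroot z L (hLR ▸ hz))))
    simpa [sub_eq_zero] using this

/-- The power with exponent `288` of the integral multiple `A` of `M` has two natural numbers as
its eigenvalues, and it is diagonalisable. -/
theorem exists_nat_eigenvalues {M : Matrix (Fin 3) (Fin 3) ℚ} {l : ℂ} {ρ : ℝ}
    (hroots : (M.map (fun q : ℚ => (q : ℂ))).charpoly.roots = {l, (starRingEnd ℂ) l, (ρ : ℂ)})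
    (him : l.im ≠ 0) (hunity : ∃ d : ℕ, 0 < d ∧ (l / (‖l‖ : ℂ)) ^ d = 1)
    {A : Matrix (Fin 3) (Fin 3) ℤ} {D : ℕ}
    (hD : D ≠ 0) (hA : A.map (fun z : ℤ => (z : ℚ)) = (D : ℚ) • M) {W : ℕ} (hW : ∀ i j, |A i j| ≤ W) :
    ∃ L R : ℕ, L ≤ (3 * W) ^ 288 ∧ R ≤ (3 * W) ^ 288 ∧
      (A ^ 288 - algebraMap ℤ _ (L : ℤ)) * (A ^ 288 - algebraMap ℤ _ (R : ℤ)) = 0 ∧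
      (L = R → A ^ 288 = algebraMap ℤ _ (L : ℤ)) := by
  obtain ⟨d, hd, hunity⟩ := hunity
  have hl0 : l ≠ 0 := by rintro rfl; simp at him
  obtain ⟨hchar, a, b, c, ha, hb, hc⟩ := cubic_charpoly_facts hroots
  obtain ⟨hconj, u, v, hu0, hv0, hu, hv⟩ := exists_rat_pow_288 ha hb hc hl0 hd hunity
  have hAM : A.map (fun z : ℤ => (z : ℂ)) = (D : ℂ) • M.map (fun q : ℚ => (q : ℂ)) := by
    ext i j
    have := congrFun (congrFun hA i) j
    simp only [Matrix.map_apply, Matrix.smul_apply, smul_eq_mul] at this ⊢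
    exact_mod_cast congrArg (fun q : ℚ => (q : ℂ)) this
  have eig : ∀ μ : ℂ, μ ∈ (M.map (fun q : ℚ => (q : ℂ))).charpoly.roots → ∀ q : ℚ, 0 ≤ q →
      μ ^ 288 = q → ∃ L : ℕ, L ≤ (3 * W) ^ 288 ∧ (L : ℚ) = D ^ 288 * q := by
    intro μ hμ q hq hμq
    obtain ⟨w, hw, hw'⟩ :=
      Matrix.exists_eigenvector_of_isRoot_charpoly (Polynomial.isRoot_of_mem_roots hμ)
    have hAw : (A.map (fun z : ℤ => (z : ℂ))).mulVec w = (D * μ) • w := by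
      rw [hAM, Matrix.smul_mulVec, hw', smul_smul]
    have hint := (Matrix.isIntegral_of_mulVec_eq_smul hw hAw).pow 288
    have hnorm := Matrix.norm_le_of_mulVec_eq_smul (W := W) hw hAw fun i j => by
      rw [Matrix.map_apply, Complex.norm_intCast]
      exact_mod_cast hW i j
    rw [mul_pow, hμq] at hint
    -- The eigenvalue `D * μ` of `A` is an algebraic integer and its power is rational.
    obtain ⟨k, hk⟩ := Int.exists_of_isIntegral_ratCast (q := D ^ 288 * q) (by push_cast; exact hint)
    have hk0 : 0 ≤ k := by
      have : (0 : ℚ) ≤ k := by rw [← hk]; positivity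
      exact_mod_cast this
    lift k to ℕ using hk0
    refine ⟨k, ?_, by rw [hk]; simp⟩
    have h1 : ‖(D * μ) ^ 288‖ ≤ (3 * (W : ℝ)) ^ 288 := by
      rw [norm_pow]
      refine pow_le_pow_left₀ (norm_nonneg _) ?_ _
      simpa using hnorm
    have h2 : (D * μ) ^ 288 = (((k : ℕ) : ℤ) : ℂ) := by
      rw [mul_pow, hμq]
      exact_mod_cast congrArg (fun q : ℚ => (q : ℂ)) hk
    rw [h2, Complex.norm_intCast] at h1
    have h3 : (k : ℝ) ≤ (3 * (W : ℝ)) ^ 288 := by simpa using h1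
    exact_mod_cast h3
  obtain ⟨L, hL, hLu⟩ := eig l (by rw [hroots]; simp) u hu0 hu
  obtain ⟨R, hR, hRv⟩ := eig (ρ : ℂ) (by rw [hroots]; simp) v hv0 hv
  have hne : ∀ w : ℂ, w.im ≠ 0 → w ≠ (ρ : ℂ) := by
    rintro w hw rfl; simp at hw
  have hlc : l ≠ (starRingEnd ℂ) l := by
    intro h
    have := congrArg Complex.im h
    rw [Complex.conj_im] at this
    exact him (by linarith)
  obtain ⟨h1, h2⟩ := pow_annihilated hchar hlc (hne l him) (hne _ (by simpa using him))
    hu (hconj.trans hu) hv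
  -- The matrix identities hold over ℂ and descend to ℤ because the entrywise embedding is
  -- injective.
  set φ : Matrix (Fin 3) (Fin 3) ℤ →+* Matrix (Fin 3) (Fin 3) ℂ := (Int.castRingHom ℂ).mapMatrix
  have hφ : Function.Injective φ := Matrix.map_injective (RingHom.injective_int (Int.castRingHom ℂ))
  have hφA : φ A = (D : ℂ) • M.map (fun q : ℚ => (q : ℂ)) := hAM
  have hφalg : ∀ (k : ℕ) (q : ℚ), (k : ℚ) = D ^ 288 * q → φ (algebraMap ℤ _ (k : ℤ)) =
      (D : ℂ) ^ 288 • algebraMap ℂ (Matrix (Fin 3) (Fin 3) ℂ) q := by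
    intro k q hk
    have hk' : (k : ℂ) = D ^ 288 * q := by exact_mod_cast congrArg (fun q : ℚ => (q : ℂ)) hk
    rw [Algebra.smul_def, ← map_mul, ← hk', map_natCast, map_natCast, map_natCast]
  refine ⟨L, R, hL, hR, hφ ?_, fun hLR => hφ ?_⟩
  · rw [map_mul, map_sub, map_sub, map_pow, hφA, hφalg L u hLu, hφalg R v hRv, smul_pow,
      ← smul_sub, ← smul_sub, smul_mul_smul_comm, h1, smul_zero, map_zero]
  · rw [map_pow, hφA, hφalg L u hLu, smul_pow, h2 ?_]
    have huv : (D : ℚ) ^ 288 * u = D ^ 288 * v := by rw [← hLu, ← hRv, hLR]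
    have hD' : (D : ℚ) ^ 288 ≠ 0 := pow_ne_zero _ (by exact_mod_cast hD)
    rw [mul_left_cancel₀ hD' huv]

theorem Matrix.abs_mul_apply_le {n : Type*} [Fintype n] {A B : Matrix n n ℤ} {V W : ℤ}
    (hA : ∀ i j, |A i j| ≤ V) (hB : ∀ i j, |B i j| ≤ W) (i j : n) :
    |(A * B) i j| ≤ Fintype.card n * (V * W) := by
  rw [Matrix.mul_apply]
  refine (Finset.abs_sum_le_sum_abs _ _).trans ?_
  rw [← nsmul_eq_mul, ← Finset.card_univ, ← Finset.sum_const]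
  refine Finset.sum_le_sum fun k _ => ?_
  rw [abs_mul]
  exact mul_le_mul (hA i k) (hB k j) (abs_nonneg _) ((abs_nonneg _).trans (hA i k))

theorem Matrix.abs_pow_apply_le {n : Type*} [Fintype n] [DecidableEq n] {A : Matrix n n ℤ} {W : ℤ}
    (hA : ∀ i j, |A i j| ≤ W) (k : ℕ) (i j : n) :
    |(A ^ k) i j| ≤ (Fintype.card n * W) ^ k := by
  induction k generalizing i j with
  | zero =>
    rw [pow_zero, pow_zero, Matrix.one_apply]
    split_ifs <;> simp
  | succ k ih =>
    rw [pow_succ]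
    refine (Matrix.abs_mul_apply_le ih hA i j).trans (le_of_eq ?_)
    ring

theorem Matrix.abs_intCast_apply_le {n : Type*} [Fintype n] [DecidableEq n] (k : ℤ) (i j : n) :
    |(algebraMap ℤ (Matrix n n ℤ) k) i j| ≤ |k| := by
  rw [Matrix.algebraMap_matrix_apply]
  split_ifs <;> simp

/-- Spectral decomposition without division: `K - R` and `L - K` are multiples of the projections to
the two eigenspaces, so multiplication by `K` scales them by `L` and `R`. -/
theorem pow_decomposition_of_annihilated {n : Type*} [Fintype n] [DecidableEq n]
    {K : Matrix n n ℤ} {L R : ℤ} (h : (K - algebraMap ℤ _ L) * (K - algebraMap ℤ _ R) = 0) (m : ℕ) :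
    (L - R) • K ^ m = L ^ m • (K - algebraMap ℤ _ R) + R ^ m • (algebraMap ℤ _ L - K) := by
  have hc : ∀ k : ℤ, algebraMap ℤ (Matrix n n ℤ) k * K = K * algebraMap ℤ _ k :=
    fun k => Algebra.commutes k K
  have h1 : (K - algebraMap ℤ _ R) * K = L • (K - algebraMap ℤ _ R) := by
    rw [Algebra.smul_def, ← sub_eq_zero, ← h, mul_sub, mul_sub, sub_mul, sub_mul, sub_mul, hc, hc,
      ← map_mul]
    abel
  have h2 : (algebraMap ℤ _ L - K) * K = R • (algebraMap ℤ _ L - K) := by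
    rw [Algebra.smul_def, ← sub_eq_zero, ← neg_eq_zero, ← h, mul_sub, mul_sub, sub_mul, sub_mul,
      sub_mul, hc, hc, ← map_mul, ← map_mul, mul_comm R L]
    abel
  induction m with
  | zero => simp [sub_smul]
  | succ m ih =>
    rw [pow_succ, ← smul_mul_assoc, ih, add_mul, smul_mul_assoc, smul_mul_assoc, h1, h2, smul_smul,
      smul_smul, ← pow_succ, ← pow_succ]

/-- The factor `e` keeps `P` and `Q` integral. The factor 2 in the bounds allows for differences of
two terms, each at most `(3 * W) ^ 288`. -/
theorem exists_pow_decomposition {M : Matrix (Fin 3) (Fin 3) ℚ} {l : ℂ} {ρ : ℝ}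
    (hroots : (M.map (fun q : ℚ => (q : ℂ))).charpoly.roots = {l, (starRingEnd ℂ) l, (ρ : ℂ)})
    (him : l.im ≠ 0) (hunity : ∃ d : ℕ, 0 < d ∧ (l / (‖l‖ : ℂ)) ^ d = 1)
    {A : Matrix (Fin 3) (Fin 3) ℤ} {D : ℕ} (hD : D ≠ 0)
    (hA : A.map (fun z : ℤ => (z : ℚ)) = (D : ℚ) • M) {W : ℕ} (hW1 : 1 ≤ W)
    (hW : ∀ i j, |A i j| ≤ W) :
    ∃ (L R : ℕ) (e : ℤ) (P Q : Matrix (Fin 3) (Fin 3) ℤ), e ≠ 0 ∧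
      L ≤ 2 * (3 * W) ^ 288 ∧ R ≤ 2 * (3 * W) ^ 288 ∧ |e| ≤ ((2 * (3 * W) ^ 288 : ℕ) : ℤ) ∧
      (∀ i j, |P i j| ≤ ((2 * (3 * W) ^ 288 : ℕ) : ℤ)) ∧
      (∀ i j, |Q i j| ≤ ((2 * (3 * W) ^ 288 : ℕ) : ℤ)) ∧
      ∀ m : ℕ, e • A ^ (288 * m) = (L : ℤ) ^ m • P + (R : ℤ) ^ m • Q := by
  obtain ⟨L, R, hL, hR, h1, h2⟩ := exists_nat_eigenvalues hroots him hunity hD hA hW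
  have hK : ∀ i j, |(A ^ 288) i j| ≤ (((3 * W) ^ 288 : ℕ) : ℤ) := by
    intro i j
    have := Matrix.abs_pow_apply_le hW 288 i j
    rw [Nat.cast_pow, Nat.cast_mul]
    exact this
  have hs : ∀ (k : ℕ), k ≤ (3 * W) ^ 288 → ∀ i j,
      |(algebraMap ℤ (Matrix (Fin 3) (Fin 3) ℤ) (k : ℤ)) i j| ≤ (((3 * W) ^ 288 : ℕ) : ℤ) := by
    intro k hk i j
    refine (Matrix.abs_intCast_apply_le _ i j).trans ?_
    rw [Nat.abs_cast]
    exact_mod_cast hk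
  have hpos : 1 ≤ (3 * W) ^ 288 := Nat.one_le_pow _ _ (by omega)
  generalize (3 * W) ^ 288 = V at *
  by_cases hLR : L = R
  -- Here `L - R` is zero and cannot serve as `e`, but the power is scalar.
  · refine ⟨L, R, 1, 1, 0, one_ne_zero, by omega, by omega, ?_, ?_, ?_, ?_⟩
    · rw [abs_one]; omega
    · intro i j
      rw [Matrix.one_apply]
      split_ifs
      · rw [abs_one]; omega
      · rw [abs_zero]; omega
    · intro i j
      simp
    · intro m
      rw [pow_mul, h2 hLR, ← map_pow, Algebra.algebraMap_eq_smul_one]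
      simp
  · refine ⟨L, R, (L : ℤ) - R, A ^ 288 - algebraMap ℤ _ (R : ℤ), algebraMap ℤ _ (L : ℤ) - A ^ 288,
      ?_, by omega, by omega, ?_, ?_, ?_, ?_⟩
    · omega
    · rw [abs_le]; omega
    · intro i j
      have := abs_le.mp (hK i j)
      have := abs_le.mp (hs R hR i j)
      rw [Matrix.sub_apply, abs_le]
      omega
    · intro i j
      have := abs_le.mp (hK i j)
      have := abs_le.mp (hs L hL i j)
      rw [Matrix.sub_apply, abs_le]
      omega
    · intro m
      rw [pow_mul]
      exact pow_decomposition_of_annihilated h1 m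

/-! ### Exponential sums and their eventual sign. -/

/-- `f m = ∑ dᵢ bᵢ ^ m` is an integral combination of powers of natural numbers at most `B`, the
absolute values of the coefficients having a sum of at most `S`. -/
def IsExpSum (B S : ℕ) (f : ℕ → ℤ) : Prop :=
  ∃ (k : ℕ) (d : Fin k → ℤ) (b : Fin k → ℕ), (∀ i, b i ≤ B) ∧ ∑ i, |d i| ≤ S ∧
    ∀ m, f m = ∑ i, d i * (b i : ℤ) ^ m

namespace IsExpSum

theorem of_fintype {ι : Type*} [Fintype ι] {B S : ℕ} {f : ℕ → ℤ} (d : ι → ℤ) (b : ι → ℕ)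
    (hb : ∀ i, b i ≤ B) (hd : ∑ i, |d i| ≤ S) (hf : ∀ m, f m = ∑ i, d i * (b i : ℤ) ^ m) :
    IsExpSum B S f := by
  let e := Fintype.equivFin ι
  refine ⟨Fintype.card ι, d ∘ e.symm, b ∘ e.symm, fun i => hb _, ?_, fun m => ?_⟩
  · rw [← Equiv.sum_comp e.symm] at hd; exact hd
  · rw [hf, ← Equiv.sum_comp e.symm]; rfl

theorem mono {B B' S S' : ℕ} {f : ℕ → ℤ} (h : IsExpSum B S f) (hB : B ≤ B') (hS : S ≤ S') :
    IsExpSum B' S' f := by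
  obtain ⟨k, d, b, hb, hd, hf⟩ := h
  exact ⟨k, d, b, fun i => (hb i).trans hB, hd.trans (by exact_mod_cast hS), hf⟩

theorem zero (B : ℕ) : IsExpSum B 0 fun _ => 0 :=
  ⟨0, Fin.elim0, Fin.elim0, fun i => i.elim0, by simp, by simp⟩

theorem const_mul_pow {c : ℤ} {b B S : ℕ} (hb : b ≤ B) (hc : |c| ≤ S) :
    IsExpSum B S fun m => c * (b : ℤ) ^ m :=
  ⟨1, fun _ => c, fun _ => b, fun _ => hb, by simpa using hc, by simp⟩

theorem const {c : ℤ} {B S : ℕ} (hB : 1 ≤ B) (hc : |c| ≤ S) : IsExpSum B S fun _ => c := by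
  simpa using const_mul_pow hB hc

theorem add {B S S' : ℕ} {f g : ℕ → ℤ} (hf : IsExpSum B S f) (hg : IsExpSum B S' g) :
    IsExpSum B (S + S') fun m => f m + g m := by
  obtain ⟨k, d, b, hb, hd, hf⟩ := hf
  obtain ⟨k', d', b', hb', hd', hg⟩ := hg
  refine of_fintype (ι := Fin k ⊕ Fin k') (Sum.elim d d') (Sum.elim b b') ?_ ?_ ?_
  · rintro (i | i)
    · exact hb i
    · exact hb' i
  · rw [Fintype.sum_sum_type]; push_cast; exact add_le_add hd hd'
  · intro m
    rw [Fintype.sum_sum_type, hf, hg]; rfl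

theorem mul {B B' S S' : ℕ} {f g : ℕ → ℤ} (hf : IsExpSum B S f) (hg : IsExpSum B' S' g) :
    IsExpSum (B * B') (S * S') fun m => f m * g m := by
  obtain ⟨k, d, b, hb, hd, hf⟩ := hf
  obtain ⟨k', d', b', hb', hd', hg⟩ := hg
  refine of_fintype (ι := Fin k × Fin k') (fun p => d p.1 * d' p.2) (fun p => b p.1 * b' p.2)
    (fun p => Nat.mul_le_mul (hb _) (hb' _)) ?_ fun m => ?_
  · simp only [abs_mul, Fintype.sum_prod_type, ← Finset.sum_mul_sum]
    push_cast
    exact mul_le_mul hd hd' (Finset.sum_nonneg fun i _ => abs_nonneg _) (by positivity)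
  · rw [hf, hg, Finset.sum_mul_sum, Fintype.sum_prod_type]
    refine Finset.sum_congr rfl fun i _ => Finset.sum_congr rfl fun j _ => ?_
    push_cast
    ring

theorem pow {B S : ℕ} {f : ℕ → ℤ} (hf : IsExpSum B S f) (k : ℕ) :
    IsExpSum (B ^ k) (S ^ k) fun m => f m ^ k := by
  induction k with
  | zero => simpa using const (c := 1) (B := 1) (S := 1) le_rfl (by simp)
  | succ k ih => simpa only [pow_succ] using ih.mul hf

theorem sum {ι : Type*} {B S : ℕ} {s : Finset ι} {f : ι → ℕ → ℤ}
    (hf : ∀ i ∈ s, IsExpSum B S (f i)) : IsExpSum B (s.card * S) fun m => ∑ i ∈ s, f i m := by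
  classical
  induction s using Finset.induction_on with
  | empty => simpa using zero B
  | insert a s ha ih =>
    simp only [Finset.sum_insert ha, Finset.card_insert_of_notMem ha]
    refine ((hf a (by simp)).add (ih fun i hi => hf i (by simp [hi]))).mono le_rfl ?_
    rw [add_mul, one_mul, add_comm]

/-- Past `B * S` the term with the largest base dominates all the others. -/
theorem sign_eq_aux (c : ℕ → ℤ) (S : ℕ) (B : ℕ) (hc : ∑ b ∈ Finset.range (B + 1), |c b| ≤ S) :
    ∃ σ : SignType, ∀ m, B * S < m →
      SignType.sign (∑ b ∈ Finset.range (B + 1), c b * (b : ℤ) ^ m) = σ := by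
  induction B with
  | zero =>
    refine ⟨0, fun m hm => ?_⟩
    -- The strict bound excludes `m = 0`, where `0 ^ 0 = 1` would contribute.
    simp [zero_pow (by omega : m ≠ 0)]
  | succ B ih =>
    have hc' : ∑ b ∈ Finset.range (B + 1), |c b| ≤ S := by
      rw [Finset.sum_range_succ] at hc
      have := abs_nonneg (c (B + 1))
      omega
    obtain ⟨σ, hσ⟩ := ih hc'
    by_cases h0 : c (B + 1) = 0
    · refine ⟨σ, fun m hm => ?_⟩
      rw [Finset.sum_range_succ, h0, zero_mul, add_zero]
      exact hσ m ((Nat.mul_le_mul_right S (Nat.le_succ B)).trans_lt hm)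
    · refine ⟨SignType.sign (c (B + 1)), fun m hm => ?_⟩
      have hm0 : m ≠ 0 := by omega
      have hsmall : |∑ b ∈ Finset.range (B + 1), c b * (b : ℤ) ^ m| ≤ S * (B : ℤ) ^ m := by
        calc |∑ b ∈ Finset.range (B + 1), c b * (b : ℤ) ^ m|
            ≤ ∑ b ∈ Finset.range (B + 1), |c b| * (B : ℤ) ^ m := by
              refine (Finset.abs_sum_le_sum_abs _ _).trans (Finset.sum_le_sum fun b hb => ?_)
              rw [abs_mul, abs_of_nonneg (by positivity : (0 : ℤ) ≤ (b : ℤ) ^ m)]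
              have : b ≤ B := by simpa [Nat.lt_succ_iff] using hb
              gcongr
          _ ≤ S * (B : ℤ) ^ m := by
              rw [← Finset.sum_mul]
              gcongr
      -- Bernoulli: `(B + 1) ^ m ≥ B ^ m + m * B ^ (m - 1)`, and `m > B * S`. As the top coefficient
      -- is a nonzero integer, its term outweighs the rest.
      have hbern : (S : ℤ) * (B : ℤ) ^ m < ((B + 1 : ℕ) : ℤ) ^ m := by
        rcases Nat.eq_zero_or_pos B with rfl | hB
        · simp [zero_pow hm0]
        obtain ⟨k, rfl⟩ := Nat.exists_eq_succ_of_ne_zero hm0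
        have h1 : (B ^ (k + 1) + (k + 1) * B ^ k : ℕ) ≤ (B + 1) ^ (k + 1) := by
          simpa using pow_add_mul_le_add_pow (Nat.zero_le B) (Nat.zero_le (2 * B + 1)) (k + 1)
        have h2 : S * B ^ (k + 1) < (k + 1) * B ^ k := by
          rw [pow_succ, mul_left_comm, mul_comm (k + 1)]
          refine Nat.mul_lt_mul_of_pos_left ?_ (by positivity)
          have : (B + 1) * S = S * B + S := by ring
          simp only [Nat.succ_eq_add_one] at hm
          omega
        have h3 : S * B ^ (k + 1) < (B + 1) ^ (k + 1) := by omega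
        exact_mod_cast h3
      have hlt := hsmall.trans_lt hbern
      have hP : (0 : ℤ) < ((B + 1 : ℕ) : ℤ) ^ m := by positivity
      rw [Finset.sum_range_succ]
      generalize ((B + 1 : ℕ) : ℤ) ^ m = P at *
      generalize ∑ b ∈ Finset.range (B + 1), c b * (b : ℤ) ^ m = T at *
      obtain ⟨hl, hu⟩ := abs_lt.mp hlt
      rcases lt_or_gt_of_ne h0 with hneg | hpos
      · rw [sign_neg hneg, sign_neg]
        nlinarith
      · rw [sign_pos hpos, sign_pos]
        nlinarith

theorem sign_eq {B S : ℕ} {f : ℕ → ℤ} (hf : IsExpSum B S f) :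
    ∃ σ : SignType, ∀ m, B * S < m → SignType.sign (f m) = σ := by
  obtain ⟨k, d, b, hb, hd, hf⟩ := hf
  have hmaps : ∀ i ∈ Finset.univ, b i ∈ Finset.range (B + 1) := fun i _ => by
    simpa [Nat.lt_succ_iff] using hb i
  -- Terms with equal bases are collected, since they may cancel; by the triangle inequality the
  -- bound `S` survives.
  have hS : ∑ β ∈ Finset.range (B + 1), |∑ i with b i = β, d i| ≤ S := by
    refine le_trans ?_ hd
    rw [← Finset.sum_fiberwise_of_maps_to hmaps]
    exact Finset.sum_le_sum fun β _ => Finset.abs_sum_le_sum_abs _ _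
  obtain ⟨σ, hσ⟩ := sign_eq_aux (fun β => ∑ i with b i = β, d i) S B hS
  refine ⟨σ, fun m hm => ?_⟩
  rw [← hσ m hm, hf, ← Finset.sum_fiberwise_of_maps_to hmaps]
  congr 1
  refine Finset.sum_congr rfl fun β _ => ?_
  rw [Finset.sum_mul]
  refine Finset.sum_congr rfl fun i hi => ?_
  rw [(Finset.mem_filter.mp hi).2]

end IsExpSum

/-! ### Homogeneous evaluation of the polynomial. -/

/-- The polynomial with coefficients `c i j k` for `0 ≤ i, j, k ≤ d`, made homogeneous of degree
`6 * d` by the variable `E`. -/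
def homogEval (d : ℕ) (c : ℕ → ℕ → ℕ → ℤ) (x : ℤ × ℤ × ℤ) (E : ℤ) : ℤ :=
  ∑ i ∈ Finset.range (d + 1), ∑ j ∈ Finset.range (d + 1), ∑ k ∈ Finset.range (d + 1),
    c i j k * (x.1 ^ i * x.2.1 ^ j * x.2.2 ^ k * E ^ (6 * d - (i + j + k)))

theorem aeval_eq_sum_coeff3 (p : MvPolynomial (Fin 3) ℤ) (y : Fin 3 → ℝ) :
    MvPolynomial.aeval y p = ∑ i ∈ Finset.range (p.totalDegree + 1),
      ∑ j ∈ Finset.range (p.totalDegree + 1), ∑ k ∈ Finset.range (p.totalDegree + 1),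
        (coeff3 p i j k : ℝ) * (y 0 ^ i * y 1 ^ j * y 2 ^ k) := by
  rw [MvPolynomial.aeval_def, MvPolynomial.eval₂_eq']
  simp only [Finset.sum_sigma', Fin.prod_univ_three]
  refine Finset.sum_bij_ne_zero (fun m _ _ => ⟨m 0, m 1, m 2⟩) ?_ ?_ ?_ ?_
  · intro m hm _
    have hle : ∀ i : Fin 3, m i < p.totalDegree + 1 := fun i => Nat.lt_succ_of_le <|
      (Finsupp.le_degree i m).trans (MvPolynomial.le_totalDegree hm)
    simp only [Finset.mem_sigma, Finset.mem_range]
    exact ⟨hle 0, hle 1, hle 2⟩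
  · intro m _ _ m' _ _ h
    simp only [Sigma.mk.injEq, heq_eq_eq] at h
    ext i
    fin_cases i
    · exact h.1
    · exact h.2.1
    · exact h.2.2
  · rintro ⟨i, j, k⟩ _ hne
    have hc : coeff3 p i j k ≠ 0 := by
      intro h0; simp [h0] at hne
    refine ⟨Finsupp.equivFunOnFinite.symm ![i, j, k], MvPolynomial.mem_support_iff.mpr hc, ?_, ?_⟩
    · simpa [coeff3] using hne
    · simp
  · intro m _ _
    have : Finsupp.equivFunOnFinite.symm ![m 0, m 1, m 2] = m := by
      ext i; fin_cases i <;> rfl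
    simp [coeff3, this, mul_assoc]

theorem sign_homogEval (p : MvPolynomial (Fin 3) ℤ) (y : Fin 3 → ℝ) {x : ℤ × ℤ × ℤ} {E : ℤ}
    (hE : E ≠ 0) (h0 : (x.1 : ℝ) = E * y 0) (h1 : (x.2.1 : ℝ) = E * y 1)
    (h2 : (x.2.2 : ℝ) = E * y 2) :
    SignType.sign (homogEval p.totalDegree (coeff3 p) x E) =
      SignType.sign (MvPolynomial.aeval y p) := by
  have key : ((homogEval p.totalDegree (coeff3 p) x E : ℤ) : ℝ) =
      (E : ℝ) ^ (6 * p.totalDegree) * MvPolynomial.aeval y p := by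
    rw [aeval_eq_sum_coeff3, homogEval]
    push_cast
    simp only [Finset.mul_sum, h0, h1, h2]
    refine Finset.sum_congr rfl fun i hi => Finset.sum_congr rfl fun j hj =>
      Finset.sum_congr rfl fun k hk => ?_
    simp only [Finset.mem_range] at hi hj hk
    have : (E : ℝ) ^ (6 * p.totalDegree) =
        E ^ i * E ^ j * E ^ k * E ^ (6 * p.totalDegree - (i + j + k)) := by
      rw [← pow_add, ← pow_add, ← pow_add]
      congr 1
      omega
    rw [this]
    ring
  -- Degree `3 * d` would already clear the denominators; doubling it makes the exponent even, so
  -- the sign of `E` is irrelevant.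
  have hpos : (0 : ℝ) < (E : ℝ) ^ (6 * p.totalDegree) :=
    Even.pow_pos (by rw [show 6 * p.totalDegree = 2 * (3 * p.totalDegree) by ring]; simp)
      (by exact_mod_cast hE)
  have hcast : SignType.sign ((homogEval p.totalDegree (coeff3 p) x E : ℤ) : ℝ) =
      SignType.sign (homogEval p.totalDegree (coeff3 p) x E) := by
    rcases lt_trichotomy (homogEval p.totalDegree (coeff3 p) x E) 0 with h | h | h
    · rw [sign_neg h, sign_neg (by exact_mod_cast h)]
    · simp [h]
    · rw [sign_pos h, sign_pos (by exact_mod_cast h)]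
  rw [← hcast, key, sign_mul, sign_pos hpos, one_mul]

theorem mem_atomicSet_iff_sign (p : MvPolynomial (Fin 3) ℤ) (strict : Bool) (y : Fin 3 → ℝ) :
    y ∈ atomicSet p strict ↔ SignType.sign (MvPolynomial.aeval y p) = 1 ∨
      (strict = false ∧ SignType.sign (MvPolynomial.aeval y p) = 0) := by
  cases strict
  · simp [atomicSet, sign_eq_one_iff, sign_eq_zero_iff, le_iff_lt_or_eq, @eq_comm ℝ 0]
  · simp [atomicSet, sign_eq_one_iff]

/-- By homogeneity every monomial has `6 * d` factors, so all terms share the same bounds for bases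
and coefficients. -/
theorem IsExpSum.homogEval {B S c₀ d : ℕ} {c : ℕ → ℕ → ℕ → ℤ} {x : ℕ → ℤ × ℤ × ℤ} {E : ℕ → ℤ}
    (hc : ∀ i ≤ d, ∀ j ≤ d, ∀ k ≤ d, |c i j k| ≤ c₀)
    (h0 : IsExpSum B S fun m => (x m).1) (h1 : IsExpSum B S fun m => (x m).2.1)
    (h2 : IsExpSum B S fun m => (x m).2.2) (hE : IsExpSum B S E) :
    IsExpSum (B ^ (6 * d)) ((d + 1) ^ 3 * (c₀ * S ^ (6 * d)))
      fun m => homogEval d c (x m) (E m) := by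
  have hterm : ∀ i ∈ Finset.range (d + 1), ∀ j ∈ Finset.range (d + 1),
      ∀ k ∈ Finset.range (d + 1), IsExpSum (B ^ (6 * d)) (c₀ * S ^ (6 * d)) fun m =>
        c i j k * ((x m).1 ^ i * (x m).2.1 ^ j * (x m).2.2 ^ k * (E m) ^ (6 * d - (i + j + k))) := by
    intro i hi j hj k hk
    simp only [Finset.mem_range, Nat.lt_succ_iff] at hi hj hk
    have hpow : ∀ T : ℕ, T ^ i * T ^ j * T ^ k * T ^ (6 * d - (i + j + k)) = T ^ (6 * d) := by
      intro T
      rw [← pow_add, ← pow_add, ← pow_add]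
      congr 1
      omega
    have := (IsExpSum.const (B := 1) le_rfl (hc i hi j hj k hk)).mul
      ((((h0.pow i).mul (h1.pow j)).mul (h2.pow k)).mul (hE.pow (6 * d - (i + j + k))))
    rwa [hpow, hpow, one_mul] at this
  have := IsExpSum.sum fun i hi => IsExpSum.sum fun j hj => IsExpSum.sum (hterm i hi j hj)
  simp only [Finset.card_range] at this
  refine this.mono le_rfl (le_of_eq ?_)
  ring

/-! ### Common denominators and bounds by bit length. -/

/-- The entries of the matrix, followed by those of the starting point. -/
def entryList (M : Matrix (Fin 3) (Fin 3) ℚ) (s : Fin 3 → ℚ) : List ℚ :=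
  [M 0 0, M 0 1, M 0 2, M 1 0, M 1 1, M 1 2, M 2 0, M 2 1, M 2 2, s 0, s 1, s 2]

/-- A common denominator of all entries. -/
def commonDen (M : Matrix (Fin 3) (Fin 3) ℚ) (s : Fin 3 → ℚ) : ℕ :=
  ((entryList M s).map Rat.den).prod

theorem matrix_mem_entryList (M : Matrix (Fin 3) (Fin 3) ℚ) (s : Fin 3 → ℚ) (i j : Fin 3) :
    M i j ∈ entryList M s := by
  fin_cases i <;> fin_cases j <;> simp [entryList]

theorem vector_mem_entryList (M : Matrix (Fin 3) (Fin 3) ℚ) (s : Fin 3 → ℚ) (i : Fin 3) :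
    s i ∈ entryList M s := by
  fin_cases i <;> simp [entryList]

theorem instanceSize_eq (M : Matrix (Fin 3) (Fin 3) ℚ) (s : Fin 3 → ℚ)
    (p : MvPolynomial (Fin 3) ℤ) :
    instanceSize M s p = ((entryList M s).map ratBits).sum + polyBits p := by
  simp [instanceSize, matrixBits, vectorBits, entryList, Fin.sum_univ_three]
  ring

theorem natAbs_le_two_pow_intBits (z : ℤ) : z.natAbs ≤ 2 ^ intBits z :=
  (Nat.lt_size_self _).le.trans (Nat.pow_le_pow_right two_pos (Nat.le_succ _))

theorem den_le_two_pow_ratBits (q : ℚ) : q.den ≤ 2 ^ ratBits q :=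
  (Nat.lt_size_self _).le.trans (Nat.pow_le_pow_right two_pos (Nat.le_add_left _ _))

theorem two_le_ratBits (q : ℚ) : 2 ≤ ratBits q := by
  have : 0 < q.den.size := Nat.size_pos.mpr q.den_pos
  unfold ratBits intBits
  omega

theorem prod_den_le (l : List ℚ) : (l.map Rat.den).prod ≤ 2 ^ (l.map ratBits).sum := by
  induction l with
  | nil => simp
  | cons q l ih =>
    rw [List.map_cons, List.map_cons, List.prod_cons, List.sum_cons, pow_add]
    exact Nat.mul_le_mul (den_le_two_pow_ratBits q) ih

theorem commonDen_le (M : Matrix (Fin 3) (Fin 3) ℚ) (s : Fin 3 → ℚ)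
    (p : MvPolynomial (Fin 3) ℤ) : commonDen M s ≤ 2 ^ instanceSize M s p := by
  rw [instanceSize_eq]
  exact (prod_den_le _).trans (Nat.pow_le_pow_right two_pos (Nat.le_add_right _ _))

theorem commonDen_pos (M : Matrix (Fin 3) (Fin 3) ℚ) (s : Fin 3 → ℚ) : 0 < commonDen M s := by
  refine Nat.pos_of_ne_zero (List.prod_ne_zero ?_)
  simp only [List.mem_map, not_exists, not_and]
  exact fun q _ => q.den_ne_zero

/-- The integral multiple `D * q` of the rational number `q`, for a multiple `D` of its
denominator. -/
def scaledNum (D : ℕ) (q : ℤ × ℕ) : ℤ := q.1 * ((D / q.2 : ℕ) : ℤ)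

theorem scaledNum_ratCode {D : ℕ} {q : ℚ} (h : q.den ∣ D) :
    ((scaledNum D (ratCode q) : ℤ) : ℚ) = D * q := by
  obtain ⟨e, rfl⟩ := h
  have hq : (q.den : ℚ) ≠ 0 := by exact_mod_cast q.den_ne_zero
  rw [scaledNum, ratCode, Nat.mul_div_cancel_left _ q.den_pos]
  push_cast
  rw [mul_right_comm, ← Rat.mul_den_eq_num q]
  ring

theorem abs_scaledNum_le (M : Matrix (Fin 3) (Fin 3) ℚ) (s : Fin 3 → ℚ)
    (p : MvPolynomial (Fin 3) ℤ) {q : ℚ} (hq : q ∈ entryList M s) :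
    |scaledNum (commonDen M s) (ratCode q)| ≤ ((2 ^ (2 * instanceSize M s p) : ℕ) : ℤ) := by
  have h1 : q.num.natAbs ≤ 2 ^ instanceSize M s p := by
    refine (natAbs_le_two_pow_intBits _).trans (Nat.pow_le_pow_right two_pos ?_)
    have h2 : ratBits q ≤ ((entryList M s).map ratBits).sum :=
      List.le_sum_of_mem (List.mem_map_of_mem hq)
    rw [instanceSize_eq]
    unfold ratBits at h2
    unfold ratBits
    omega
  rw [Int.abs_eq_natAbs, scaledNum, Int.natAbs_mul, Int.natAbs_natCast, two_mul, pow_add]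
  exact_mod_cast Nat.mul_le_mul h1 ((Nat.div_le_self _ _).trans (commonDen_le M s p))

theorem den_dvd_commonDen {M : Matrix (Fin 3) (Fin 3) ℚ} {s : Fin 3 → ℚ} {q : ℚ}
    (hq : q ∈ entryList M s) : q.den ∣ commonDen M s :=
  List.dvd_prod (List.mem_map_of_mem hq)

theorem length_coeffList (p : MvPolynomial (Fin 3) ℤ) :
    (coeffList p).length = (p.totalDegree + 1) ^ 3 := by
  simp [coeffList, List.length_flatMap]
  ring

theorem List.length_le_sum_map {α : Type*} {f : α → ℕ} (hf : ∀ a, 1 ≤ f a) (l : List α) :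
    l.length ≤ (l.map f).sum := by
  induction l with
  | nil => simp
  | cons a l ih =>
    have := hf a
    simp only [List.length_cons, List.map_cons, List.sum_cons]
    omega

/-- The dense list stores zeros too, each costing at least one bit. This bounds the degree, which
enters the exponents, by the size. -/
theorem succ_totalDegree_pow_three_le (p : MvPolynomial (Fin 3) ℤ) :
    (p.totalDegree + 1) ^ 3 ≤ polyBits p := by
  rw [← length_coeffList]
  exact List.length_le_sum_map (fun z => Nat.le_add_left _ _) _

theorem abs_coeff3_le (p : MvPolynomial (Fin 3) ℤ) {i j k : ℕ} (hi : i ≤ p.totalDegree)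
    (hj : j ≤ p.totalDegree) (hk : k ≤ p.totalDegree) :
    |coeff3 p i j k| ≤ ((2 ^ polyBits p : ℕ) : ℤ) := by
  have hmem : coeff3 p i j k ∈ coeffList p := by
    simp only [coeffList, List.mem_flatMap, List.mem_map, List.mem_range]
    exact ⟨i, by omega, j, by omega, k, by omega, rfl⟩
  rw [Int.abs_eq_natAbs]
  exact_mod_cast (natAbs_le_two_pow_intBits _).trans (Nat.pow_le_pow_right two_pos
    (List.le_sum_of_mem (List.mem_map_of_mem hmem)))

theorem le_instanceSize (M : Matrix (Fin 3) (Fin 3) ℚ) (s : Fin 3 → ℚ)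
    (p : MvPolynomial (Fin 3) ℤ) : 25 ≤ instanceSize M s p := by
  have h1 := succ_totalDegree_pow_three_le p
  have h2 : 1 ≤ (p.totalDegree + 1) ^ 3 := Nat.one_le_pow _ _ (by omega)
  rw [instanceSize_eq]
  simp only [entryList, List.map_cons, List.map_nil, List.sum_cons, List.sum_nil]
  have h := two_le_ratBits
  linarith [h (M 0 0), h (M 0 1), h (M 0 2), h (M 1 0), h (M 1 1), h (M 1 2), h (M 2 0),
    h (M 2 1), h (M 2 2), h (s 0), h (s 1), h (s 2)]

/-- The matrix multiplied by the common denominator. -/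
def intMatrix (M : Matrix (Fin 3) (Fin 3) ℚ) (s : Fin 3 → ℚ) : Matrix (Fin 3) (Fin 3) ℤ :=
  Matrix.of fun i j => scaledNum (commonDen M s) (ratCode (M i j))

/-- The starting point multiplied by the common denominator. -/
def intVector (M : Matrix (Fin 3) (Fin 3) ℚ) (s : Fin 3 → ℚ) : Fin 3 → ℤ :=
  fun i => scaledNum (commonDen M s) (ratCode (s i))

theorem map_intMatrix (M : Matrix (Fin 3) (Fin 3) ℚ) (s : Fin 3 → ℚ) :
    (intMatrix M s).map (fun z : ℤ => (z : ℚ)) = (commonDen M s : ℚ) • M := by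
  ext i j
  exact scaledNum_ratCode (den_dvd_commonDen (matrix_mem_entryList M s i j))

/-- The exponent `n + 1` counts `n` factors from the matrix and one from the starting point. -/
theorem intMatrix_pow_mulVec (M : Matrix (Fin 3) (Fin 3) ℚ) (s : Fin 3 → ℚ) (n : ℕ) (i : Fin 3) :
    (((intMatrix M s ^ n).mulVec (intVector M s) i : ℤ) : ℝ) =
      (((commonDen M s : ℤ) ^ (n + 1) : ℤ) : ℝ) * (((M ^ n).mulVec s i : ℚ) : ℝ) := by
  have hpow : (intMatrix M s ^ n).map (fun z : ℤ => (z : ℚ)) = (commonDen M s : ℚ) ^ n • M ^ n := by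
    have h := map_pow (Int.castRingHom ℚ).mapMatrix (intMatrix M s) n
    rw [← smul_pow, ← map_intMatrix]
    exact h
  have hvec : (fun i => ((intVector M s i : ℤ) : ℚ)) = (commonDen M s : ℚ) • s := by
    ext i
    exact scaledNum_ratCode (den_dvd_commonDen (vector_mem_entryList M s i))
  have h : (((intMatrix M s ^ n).mulVec (intVector M s) i : ℤ) : ℚ) =
      (commonDen M s : ℚ) ^ (n + 1) * (M ^ n).mulVec s i := by
    have h1 : (((intMatrix M s ^ n).mulVec (intVector M s) i : ℤ) : ℚ) =
        ((intMatrix M s ^ n).map (fun z : ℤ => (z : ℚ))).mulVec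
          (fun i => ((intVector M s i : ℤ) : ℚ)) i :=
      RingHom.map_mulVec (Int.castRingHom ℚ) (intMatrix M s ^ n) (intVector M s) i
    rw [h1, hpow, hvec, Matrix.smul_mulVec, Matrix.mulVec_smul, smul_smul, pow_succ]
    rfl
  exact_mod_cast congrArg (fun q : ℚ => (q : ℝ)) h

theorem Matrix.abs_mulVec_le {n : Type*} [Fintype n] {A : Matrix n n ℤ} {v : n → ℤ} {V W : ℤ}
    (hA : ∀ i j, |A i j| ≤ V) (hv : ∀ j, |v j| ≤ W) (i : n) :
    |A.mulVec v i| ≤ Fintype.card n * (V * W) := by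
  refine (Finset.abs_sum_le_sum_abs _ _).trans ?_
  rw [← nsmul_eq_mul, ← Finset.card_univ, ← Finset.sum_const]
  refine Finset.sum_le_sum fun k _ => ?_
  rw [abs_mul]
  exact mul_le_mul (hA i k) (hv k) (abs_nonneg _) ((abs_nonneg _).trans (hA i k))

/-! ### The orbit along a residue class as an exponential sum. -/

theorem exists_expSum_orbit {M : Matrix (Fin 3) (Fin 3) ℚ} (s : Fin 3 → ℚ)
    (p : MvPolynomial (Fin 3) ℤ) {l : ℂ} {ρ : ℝ}
    (hroots : (M.map (fun q : ℚ => (q : ℂ))).charpoly.roots = {l, (starRingEnd ℂ) l, (ρ : ℂ)})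
    (him : l.im ≠ 0) (hunity : ∃ d : ℕ, 0 < d ∧ (l / (‖l‖ : ℂ)) ^ d = 1) {r : ℕ} (hr : r < 288) :
    ∃ (x : Fin 3 → ℕ → ℤ) (E : ℕ → ℤ),
      (∀ i, IsExpSum (2 ^ (1740 * instanceSize M s p)) (2 ^ (1740 * instanceSize M s p)) (x i)) ∧
      IsExpSum (2 ^ (1740 * instanceSize M s p)) (2 ^ (1740 * instanceSize M s p)) E ∧
      (∀ m, E m ≠ 0) ∧
      ∀ i m, (x i m : ℝ) = E m * (((M ^ (288 * m + r)).mulVec s i : ℚ) : ℝ) := by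
  have hD := commonDen_pos M s
  have hDle := commonDen_le M s p
  have hs := le_instanceSize M s p
  have hA : ∀ i j, |intMatrix M s i j| ≤ ((2 ^ (2 * instanceSize M s p) : ℕ) : ℤ) :=
    fun i j => abs_scaledNum_le M s p (matrix_mem_entryList M s i j)
  have hv : ∀ i, |intVector M s i| ≤ ((2 ^ (2 * instanceSize M s p) : ℕ) : ℤ) :=
    fun i => abs_scaledNum_le M s p (vector_mem_entryList M s i)
  obtain ⟨L, R, e, P, Q, he, hL, hR, heV, hP, hQ, hdec⟩ :=
    exists_pow_decomposition hroots him hunity hD.ne' (map_intMatrix M s) Nat.one_le_two_pow hA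
  set A := intMatrix M s
  set v := intVector M s
  set D := commonDen M s
  set h := instanceSize M s p
  -- All quantities are measured in powers of `U`; 1740 is `3 * 580`.
  obtain ⟨U, hU⟩ : ∃ U : ℕ, U = 2 ^ (3 * h) := ⟨_, rfl⟩
  have hbig : 2 ^ (1740 * h) = U ^ 580 := by rw [hU, ← pow_mul]; congr 1; ring
  have hU1 : 32 ≤ U := by
    rw [hU]
    exact (by norm_num : 32 = 2 ^ 5).le.trans (Nat.pow_le_pow_right two_pos (by omega))
  have hpowU : ∀ a b : ℕ, a ≤ b → U ^ a ≤ U ^ b := fun a b hab =>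
    Nat.pow_le_pow_right (by omega) hab
  have h3W : 3 * 2 ^ (2 * h) ≤ U := by
    calc 3 * 2 ^ (2 * h) ≤ 2 ^ h * 2 ^ (2 * h) := by
          refine Nat.mul_le_mul_right _ ?_
          exact (by norm_num : 3 ≤ 2 ^ 2).trans (Nat.pow_le_pow_right two_pos (by omega))
      _ = U := by rw [hU, ← pow_add]; congr 1; ring
  have hWU : 2 ^ (2 * h) ≤ U := by omega
  have hDU : D ≤ U := hDle.trans (by rw [hU]; exact Nat.pow_le_pow_right two_pos (by omega))
  have hV : 2 * (3 * 2 ^ (2 * h)) ^ 288 ≤ U ^ 289 := by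
    rw [show U ^ 289 = U * U ^ 288 from pow_succ' U 288]
    exact Nat.mul_le_mul (by omega) (Nat.pow_le_pow_left h3W 288)
  have hVz : ((2 * (3 * 2 ^ (2 * h)) ^ 288 : ℕ) : ℤ) ≤ (U : ℤ) ^ 289 := by exact_mod_cast hV
  have hAr : ∀ i j, |(A ^ r) i j| ≤ (U : ℤ) ^ 288 := by
    intro i j
    refine (Matrix.abs_pow_apply_le hA r i j).trans ?_
    have h1 : (3 * 2 ^ (2 * h)) ^ r ≤ U ^ 288 :=
      (Nat.pow_le_pow_left h3W r).trans (hpowU _ _ hr.le)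
    rw [Fintype.card_fin]
    exact_mod_cast h1
  have hvU : ∀ i, |v i| ≤ (U : ℤ) := fun i => (hv i).trans (by exact_mod_cast hWU)
  -- The exponent is `578 = 289 + 288 + 1`, from `T`, `A ^ r` and `v`; the 9 comes from two
  -- matrix-vector products in dimension 3.
  have hcoef : ∀ T : Matrix (Fin 3) (Fin 3) ℤ,
      (∀ i j, |T i j| ≤ ((2 * (3 * 2 ^ (2 * h)) ^ 288 : ℕ) : ℤ)) →
      ∀ i, |T.mulVec ((A ^ r).mulVec v) i| ≤ ((9 * U ^ 578 : ℕ) : ℤ) := by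
    intro T hT i
    refine (Matrix.abs_mulVec_le (fun i j => (hT i j).trans hVz)
      (Matrix.abs_mulVec_le hAr hvU) i).trans (le_of_eq ?_)
    rw [Fintype.card_fin]
    push_cast
    ring
  have hLU : L ≤ U ^ 580 := hL.trans (hV.trans (hpowU _ _ (by norm_num)))
  have hRU : R ≤ U ^ 580 := hR.trans (hV.trans (hpowU _ _ (by norm_num)))
  rw [hbig]
  refine ⟨fun i m => P.mulVec ((A ^ r).mulVec v) i * (L : ℤ) ^ m +
    Q.mulVec ((A ^ r).mulVec v) i * (R : ℤ) ^ m,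
    fun m => e * (D : ℤ) ^ (r + 1) * ((D ^ 288 : ℕ) : ℤ) ^ m, ?_, ?_, ?_, ?_⟩
  · intro i
    refine ((IsExpSum.const_mul_pow hLU (hcoef P hP i)).add
      (IsExpSum.const_mul_pow hRU (hcoef Q hQ i))).mono le_rfl ?_
    calc 9 * U ^ 578 + 9 * U ^ 578 = 18 * U ^ 578 := by ring
      _ ≤ U * U ^ 578 := Nat.mul_le_mul_right _ (by omega)
      _ ≤ U ^ 580 := by rw [← pow_succ']; exact hpowU _ _ (by norm_num)
  · refine IsExpSum.const_mul_pow
      ((Nat.pow_le_pow_left hDU 288).trans (hpowU _ _ (by norm_num))) ?_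
    have hDr : D ^ (r + 1) ≤ U ^ 288 := (Nat.pow_le_pow_left hDU _).trans (hpowU _ _ (by omega))
    have hDr' : (D : ℤ) ^ (r + 1) ≤ (U : ℤ) ^ 288 := by exact_mod_cast hDr
    rw [abs_mul, abs_of_nonneg (by positivity : (0 : ℤ) ≤ (D : ℤ) ^ (r + 1))]
    calc |e| * (D : ℤ) ^ (r + 1) ≤ (U : ℤ) ^ 289 * (U : ℤ) ^ 288 :=
          mul_le_mul (heV.trans hVz) hDr' (by positivity) (by positivity)
      _ ≤ ((U ^ 580 : ℕ) : ℤ) := by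
          rw [← pow_add]
          exact_mod_cast hpowU _ _ (by norm_num)
  · intro m
    have : (D : ℤ) ≠ 0 := by exact_mod_cast hD.ne'
    have : ((D ^ 288 : ℕ) : ℤ) ≠ 0 := by exact_mod_cast (pow_pos hD 288).ne'
    positivity
  · intro i m
    have h1 : P.mulVec ((A ^ r).mulVec v) i * (L : ℤ) ^ m +
        Q.mulVec ((A ^ r).mulVec v) i * (R : ℤ) ^ m = e * (A ^ (288 * m + r)).mulVec v i := by
      have h2 := congrFun (congrArg (fun T => T.mulVec ((A ^ r).mulVec v)) (hdec m)) i
      simp only [Matrix.add_mulVec, Matrix.smul_mulVec, Pi.add_apply, Pi.smul_apply,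
        smul_eq_mul] at h2
      rw [Matrix.mulVec_mulVec, ← pow_add] at h2
      rw [h2]
      ring
    have h3 := intMatrix_pow_mulVec M s (288 * m + r) i
    beta_reduce
    rw [h1, Int.cast_mul, h3, ← mul_assoc, ← Int.cast_mul]
    congr 2
    rw [Nat.cast_pow, ← pow_mul]
    ring

/-- Along each residue class modulo `288` the sign of the polynomial at the points of the orbit is
eventually constant, with an exponential bound. -/
theorem sign_eventually_const {M : Matrix (Fin 3) (Fin 3) ℚ} (s : Fin 3 → ℚ)
    (p : MvPolynomial (Fin 3) ℤ) {l : ℂ} {ρ : ℝ}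
    (hroots : (M.map (fun q : ℚ => (q : ℂ))).charpoly.roots = {l, (starRingEnd ℂ) l, (ρ : ℂ)})
    (him : l.im ≠ 0) (hunity : ∃ d : ℕ, 0 < d ∧ (l / (‖l‖ : ℂ)) ^ d = 1) {r : ℕ} (hr : r < 288) :
    ∃ σ : SignType, ∀ m, 2 ^ (20881 * instanceSize M s p ^ 2) < m →
      SignType.sign (MvPolynomial.aeval
        (fun i => (((M ^ (288 * m + r)).mulVec s i : ℚ) : ℝ)) p) = σ := by
  obtain ⟨x, E, hx, hE, hE0, hxE⟩ := exists_expSum_orbit s p hroots him hunity hr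
  have hpoly : polyBits p ≤ instanceSize M s p := Nat.le_add_left _ _
  have hsum := (IsExpSum.homogEval (x := fun m => (x 0 m, x 1 m, x 2 m))
    (fun i hi j hj k hk => abs_coeff3_le p hi hj hk) (hx 0) (hx 1) (hx 2) hE)
  obtain ⟨σ, hσ⟩ := hsum.sign_eq
  refine ⟨σ, fun m hm => ?_⟩
  rw [← hσ m ?_]
  · exact (sign_homogEval p _ (hE0 m) (hxE 0 m) (hxE 1 m) (hxE 2 m)).symm
  · refine lt_of_le_of_lt ?_ hm
    have h3 := (succ_totalDegree_pow_three_le p).trans hpoly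
    have hs := le_instanceSize M s p
    generalize instanceSize M s p = h at *
    generalize polyBits p = b at *
    generalize p.totalDegree = d at *
    have hd : d ≤ h := by nlinarith [Nat.le_self_pow (n := 3) (by norm_num) (d + 1)]
    have h1 : (d + 1) ^ 3 ≤ 2 ^ h := h3.trans Nat.lt_two_pow_self.le
    have h2 : 2 ^ b ≤ 2 ^ h := Nat.pow_le_pow_right two_pos hpoly
    -- Here `10440 = 6 * 1740`. This factor occurs in both bounds, for bases and for coefficients;
    -- the remaining `2 * h` in the exponent is absorbed by one more `h ^ 2`.
    have h4 : (2 ^ (1740 * h)) ^ (6 * d) ≤ 2 ^ (10440 * h ^ 2) := by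
      rw [← pow_mul]
      refine Nat.pow_le_pow_right two_pos ?_
      nlinarith [Nat.mul_le_mul_left h hd]
    calc (2 ^ (1740 * h)) ^ (6 * d) * ((d + 1) ^ 3 * (2 ^ b * (2 ^ (1740 * h)) ^ (6 * d)))
        ≤ 2 ^ (10440 * h ^ 2) * (2 ^ h * (2 ^ h * 2 ^ (10440 * h ^ 2))) := by gcongr
      _ = 2 ^ (10440 * h ^ 2 + (h + (h + 10440 * h ^ 2))) := by simp only [pow_add]
      _ ≤ 2 ^ (20881 * h ^ 2) := Nat.pow_le_pow_right two_pos (by nlinarith)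

/-! ### Primitive recursive sums, products and integer arithmetic. -/

theorem Primrec₂.monoid_pow {M : Type*} [Monoid M] [Primcodable M]
    (hmul : Primrec₂ fun a b : M => a * b) : Primrec₂ fun (a : M) (n : ℕ) => a ^ n := by
  refine (Primrec.nat_rec (f := fun _ : M => (1 : M)) (g := fun a q => q.2 * a) (Primrec.const 1)
    (hmul.comp (Primrec.snd.comp Primrec.snd) Primrec.fst)).of_eq fun a n => ?_
  induction n with
  | zero => simp
  | succ n ih => simp only [pow_succ, ← ih]

theorem Primrec.finset_sum_range {α M : Type*} [Primcodable α] [AddCommMonoid M] [Primcodable M]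
    (hadd : Primrec₂ fun a b : M => a + b) {f : α → ℕ} {g : α → ℕ → M} (hf : Primrec f)
    (hg : Primrec₂ g) : Primrec fun a => ∑ i ∈ Finset.range (f a), g a i := by
  refine (Primrec.nat_rec' (g := fun _ => (0 : M)) (h := fun a q => q.2 + g a q.1) hf
    (Primrec.const 0) (hadd.comp (Primrec.snd.comp Primrec.snd)
      (hg.comp Primrec.fst (Primrec.fst.comp Primrec.snd)))).of_eq fun a => ?_
  induction f a with
  | zero => simp
  | succ n ih => simp only [Finset.sum_range_succ, ← ih]

theorem Primrec.list_sum_map {α β : Type*} [Primcodable α] [Primcodable β] {f : α → List β}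
    {g : β → ℕ} (hf : Primrec f) (hg : Primrec g) : Primrec fun a => ((f a).map g).sum := by
  refine (Primrec.list_foldr (h := fun _ q => g q.1 + q.2) hf (Primrec.const 0)
    (Primrec.nat_add.comp (hg.comp (Primrec.fst.comp Primrec.snd))
      (Primrec.snd.comp Primrec.snd))).of_eq fun a => ?_
  induction f a with
  | nil => simp
  | cons b l ih => simp [ih]

theorem Primrec.list_prod_map {α β : Type*} [Primcodable α] [Primcodable β] {f : α → List β}
    {g : β → ℕ} (hf : Primrec f) (hg : Primrec g) : Primrec fun a => ((f a).map g).prod := by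
  refine (Primrec.list_foldr (h := fun _ q => g q.1 * q.2) hf (Primrec.const 1)
    (Primrec.nat_mul.comp (hg.comp (Primrec.fst.comp Primrec.snd))
      (Primrec.snd.comp Primrec.snd))).of_eq fun a => ?_
  induction f a with
  | nil => simp
  | cons b l ih => simp [ih]

/-- The encoding sends `n ≥ 0` to `2 * n` and `-(n + 1)` to `2 * n + 1`, so parity gives the sign.
-/
theorem Primrec.int_toNat : Primrec Int.toNat := by
  refine (Primrec.ite (c := fun z : ℤ => Encodable.encode z % 2 = 0)
    (Primrec.eq.comp (Primrec.nat_mod.comp Primrec.encode (Primrec.const 2)) (Primrec.const 0))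
    (Primrec.nat_div.comp Primrec.encode (Primrec.const 2)) (Primrec.const 0)).of_eq ?_
  rintro (n | n)
  · have : Encodable.encode (Int.ofNat n) = 2 * n := rfl
    rw [this]; simp
  · have : Encodable.encode (Int.negSucc n) = 2 * n + 1 := rfl
    rw [this]; simp

theorem Primrec.int_toNat_neg : Primrec fun z : ℤ => (-z).toNat := by
  refine (Primrec.ite (c := fun z : ℤ => Encodable.encode z % 2 = 0)
    (Primrec.eq.comp (Primrec.nat_mod.comp Primrec.encode (Primrec.const 2)) (Primrec.const 0))
    (Primrec.const 0)
    (Primrec.succ.comp (Primrec.nat_div.comp Primrec.encode (Primrec.const 2)))).of_eq ?_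
  rintro (n | n)
  · have : Encodable.encode (Int.ofNat n) = 2 * n := rfl
    rw [this]; simp
  · have : Encodable.encode (Int.negSucc n) = 2 * n + 1 := rfl
    rw [this, Int.neg_negSucc]
    simp
    omega

/-- Integer addition and multiplication reduce to this: split each argument into positive and
negative parts, compute in ℕ and subtract once. -/
theorem Primrec₂.int_sub_natCast : Primrec₂ fun m n : ℕ => (m : ℤ) - (n : ℤ) := by
  refine ((Primrec.ofNat ℤ).comp (Primrec.ite (c := fun q : ℕ × ℕ => q.2 ≤ q.1)
    (Primrec.nat_le.comp Primrec.snd Primrec.fst)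
    (Primrec.nat_double.comp (Primrec.nat_sub.comp Primrec.fst Primrec.snd))
    (Primrec.nat_double_succ.comp (Primrec.nat_sub.comp
      (Primrec.nat_sub.comp Primrec.snd Primrec.fst) (Primrec.const 1))))).of_eq ?_
  rintro ⟨m, n⟩
  dsimp only
  apply Encodable.encode_injective
  rw [Denumerable.encode_ofNat]
  split_ifs with h
  · obtain ⟨k, rfl⟩ := Nat.exists_eq_add_of_le h
    have h1 : ((n + k : ℕ) : ℤ) - n = Int.ofNat k := by simp
    rw [h1, Nat.add_sub_cancel_left]
    rfl
  · obtain ⟨k, rfl⟩ := Nat.exists_eq_add_of_lt (not_le.mp h)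
    have h1 : (m : ℤ) - ((m + k + 1 : ℕ) : ℤ) = Int.negSucc k := by
      rw [Int.negSucc_eq]; push_cast; ring
    rw [h1, show m + k + 1 - m - 1 = k by omega]
    rfl

theorem Primrec.int_natCast : Primrec fun n : ℕ => (n : ℤ) :=
  (Primrec₂.int_sub_natCast.comp Primrec.id (Primrec.const 0)).of_eq fun n => by simp

theorem Primrec.int_natAbs : Primrec Int.natAbs :=
  (Primrec.nat_add.comp Primrec.int_toNat Primrec.int_toNat_neg).of_eq fun z => by
    omega

theorem Primrec₂.int_add : Primrec₂ fun a b : ℤ => a + b := by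
  have pos := Primrec.int_toNat
  have neg := Primrec.int_toNat_neg
  refine (Primrec₂.int_sub_natCast.comp
    (Primrec.nat_add.comp (pos.comp Primrec.fst) (pos.comp Primrec.snd))
    (Primrec.nat_add.comp (neg.comp Primrec.fst) (neg.comp Primrec.snd))).of_eq ?_
  rintro ⟨a, b⟩
  dsimp only
  omega

theorem Primrec₂.int_mul : Primrec₂ fun a b : ℤ => a * b := by
  have pos := Primrec.int_toNat
  have neg := Primrec.int_toNat_neg
  refine (Primrec₂.int_sub_natCast.comp
    (Primrec.nat_add.comp (Primrec.nat_mul.comp (pos.comp Primrec.fst) (pos.comp Primrec.snd))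
      (Primrec.nat_mul.comp (neg.comp Primrec.fst) (neg.comp Primrec.snd)))
    (Primrec.nat_add.comp (Primrec.nat_mul.comp (pos.comp Primrec.fst) (neg.comp Primrec.snd))
      (Primrec.nat_mul.comp (neg.comp Primrec.fst) (pos.comp Primrec.snd)))).of_eq ?_
  rintro ⟨a, b⟩
  have ha := Int.toNat_sub_toNat_neg a
  have hb := Int.toNat_sub_toNat_neg b
  dsimp only
  conv_rhs => rw [← ha, ← hb]
  push_cast
  ring

theorem PrimrecPred.int_pos : PrimrecPred fun z : ℤ => 0 < z :=
  (Primrec.nat_lt.comp (Primrec.const 0) Primrec.int_toNat).of_eq fun z => by omega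

theorem PrimrecPred.int_nonneg : PrimrecPred fun z : ℤ => 0 ≤ z :=
  (Primrec.eq.comp Primrec.int_toNat_neg (Primrec.const 0)).of_eq fun z => by omega

/-! ### The algorithm on codes and its primitive recursiveness. -/

namespace InstanceCode

/-- The product of all denominators. -/
def den (x : InstanceCode) : ℕ := ((x.1 ++ x.2.1).map Prod.snd).prod

/-- The entry with index `t` of the integral multiple of the matrix. -/
def matrixEntry (x : InstanceCode) (t : ℕ) : ℤ := scaledNum x.den (x.1.getD t (0, 1))

/-- The entry with index `t` of the integral multiple of the starting point. -/
def vectorEntry (x : InstanceCode) (t : ℕ) : ℤ := scaledNum x.den (x.2.1.getD t (0, 1))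

/-- Multiplication by the integral multiple of the matrix. -/
def step (x : InstanceCode) (v : ℤ × ℤ × ℤ) : ℤ × ℤ × ℤ :=
  (x.matrixEntry 0 * v.1 + x.matrixEntry 1 * v.2.1 + x.matrixEntry 2 * v.2.2,
    x.matrixEntry 3 * v.1 + x.matrixEntry 4 * v.2.1 + x.matrixEntry 5 * v.2.2,
    x.matrixEntry 6 * v.1 + x.matrixEntry 7 * v.2.1 + x.matrixEntry 8 * v.2.2)

/-- The orbit of the integral multiple of the starting point. -/
def orbit (x : InstanceCode) (n : ℕ) : ℤ × ℤ × ℤ :=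
  x.step^[n] (x.vectorEntry 0, x.vectorEntry 1, x.vectorEntry 2)

/-- The coefficient with multi-index `(i, j, k)`, read from the dense list. -/
def coeff (x : InstanceCode) (i j k : ℕ) : ℤ :=
  x.2.2.1.2.getD ((i * (x.2.2.1.1 + 1) + j) * (x.2.2.1.1 + 1) + k) 0

/-- An integer with the sign of the polynomial at the point with index `n` of the orbit. -/
def value (x : InstanceCode) (n : ℕ) : ℤ :=
  homogEval x.2.2.1.1 x.coeff (x.orbit n) ((x.den : ℤ) ^ (n + 1))

/-- An upper bound for the bit length of the instance. -/
def sizeBound (x : InstanceCode) : ℕ :=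
  ((x.1 ++ x.2.1).map fun q => q.1.natAbs + 1 + q.2).sum +
    (x.2.2.1.2.map fun z => z.natAbs + 1).sum

/-- An index in the residue class of `r` modulo `288` past which the sign is constant. -/
def testIndex (x : InstanceCode) (r : ℕ) : ℕ := 288 * 2 ^ x.sizeBound ^ 6 + r

/-- The sign condition holds at the test index in the residue class of `r`. -/
def Holds (x : InstanceCode) (r : ℕ) : Prop :=
  0 < x.value (x.testIndex r) ∨ (x.2.2.2 = false ∧ 0 ≤ x.value (x.testIndex r))

instance (x : InstanceCode) (r : ℕ) : Decidable (x.Holds r) :=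
  inferInstanceAs (Decidable (_ ∨ _))

/-- The residue classes in which the sign condition holds eventually, found by evaluating the
polynomial at one point for each of them. -/
def residues (x : InstanceCode) : List ℕ :=
  (List.range 288).filterMap fun r => if x.Holds r then some r else none

theorem mem_residues {x : InstanceCode} {r : ℕ} : r ∈ x.residues ↔ r < 288 ∧ x.Holds r := by
  simp [residues, List.mem_filterMap]

theorem primrec_entries : Primrec fun x : InstanceCode => x.1 ++ x.2.1 :=
  Primrec.list_append.comp Primrec.fst (Primrec.fst.comp Primrec.snd)

theorem primrec_den : Primrec den :=
  Primrec.list_prod_map primrec_entries Primrec.snd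

theorem primrec_scaledNum : Primrec₂ scaledNum :=
  Primrec₂.int_mul.comp (Primrec.fst.comp Primrec.snd) (Primrec.int_natCast.comp
    (Primrec.nat_div.comp Primrec.fst (Primrec.snd.comp Primrec.snd)))

theorem primrec_matrixEntry (t : ℕ) : Primrec fun x => matrixEntry x t :=
  primrec_scaledNum.comp primrec_den
    ((Primrec.list_getD (0, 1)).comp Primrec.fst (Primrec.const t))

theorem primrec_vectorEntry (t : ℕ) : Primrec fun x => vectorEntry x t :=
  primrec_scaledNum.comp primrec_den
    ((Primrec.list_getD (0, 1)).comp (Primrec.fst.comp Primrec.snd) (Primrec.const t))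

theorem primrec_step : Primrec₂ step := by
  have entry : ∀ t, Primrec fun q : InstanceCode × ℤ × ℤ × ℤ => q.1.matrixEntry t := fun t =>
    (primrec_matrixEntry t).comp Primrec.fst
  have row : ∀ t t' t'' : ℕ, Primrec fun q : InstanceCode × ℤ × ℤ × ℤ =>
      q.1.matrixEntry t * q.2.1 + q.1.matrixEntry t' * q.2.2.1 + q.1.matrixEntry t'' * q.2.2.2 :=
    fun t t' t'' => Primrec₂.int_add.comp (Primrec₂.int_add.comp
      (Primrec₂.int_mul.comp (entry t) (Primrec.fst.comp Primrec.snd))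
      (Primrec₂.int_mul.comp (entry t') (Primrec.fst.comp (Primrec.snd.comp Primrec.snd))))
      (Primrec₂.int_mul.comp (entry t'') (Primrec.snd.comp (Primrec.snd.comp Primrec.snd)))
  exact (row 0 1 2).pair ((row 3 4 5).pair (row 6 7 8))

theorem primrec_orbit : Primrec₂ orbit :=
  Primrec.nat_iterate Primrec.snd
    (((primrec_vectorEntry 0).pair ((primrec_vectorEntry 1).pair (primrec_vectorEntry 2))).comp
      Primrec.fst)
    (primrec_step.comp (Primrec.fst.comp Primrec.fst) Primrec.snd)

theorem primrec_degree : Primrec fun x : InstanceCode => x.2.2.1.1 :=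
  Primrec.fst.comp (Primrec.fst.comp (Primrec.snd.comp Primrec.snd))

theorem primrec_coeffs : Primrec fun x : InstanceCode => x.2.2.1.2 :=
  Primrec.snd.comp (Primrec.fst.comp (Primrec.snd.comp Primrec.snd))

theorem primrec_coeff :
    Primrec fun q : InstanceCode × ℕ × ℕ × ℕ => q.1.coeff q.2.1 q.2.2.1 q.2.2.2 := by
  have hd : Primrec fun q : InstanceCode × ℕ × ℕ × ℕ => q.1.2.2.1.1 + 1 :=
    Primrec.succ.comp (primrec_degree.comp Primrec.fst)
  exact (Primrec.list_getD 0).comp (primrec_coeffs.comp Primrec.fst)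
    (Primrec.nat_add.comp (Primrec.nat_mul.comp (Primrec.nat_add.comp
      (Primrec.nat_mul.comp (Primrec.fst.comp Primrec.snd) hd)
      (Primrec.fst.comp (Primrec.snd.comp Primrec.snd))) hd)
      (Primrec.snd.comp (Primrec.snd.comp Primrec.snd)))

theorem primrec_homogEval_term :
    Primrec fun t : (ℤ × ℕ) × (ℤ × ℤ × ℤ) × ℤ × ℕ × ℕ × ℕ =>
      t.1.1 * (t.2.1.1 ^ t.2.2.2.1 * t.2.1.2.1 ^ t.2.2.2.2.1 * t.2.1.2.2 ^ t.2.2.2.2.2 *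
        t.2.2.1 ^ (6 * t.1.2 - (t.2.2.2.1 + t.2.2.2.2.1 + t.2.2.2.2.2))) := by
  have zpow := Primrec₂.monoid_pow Primrec₂.int_mul
  have hx : Primrec fun t : (ℤ × ℕ) × (ℤ × ℤ × ℤ) × ℤ × ℕ × ℕ × ℕ => t.2.1 :=
    Primrec.fst.comp Primrec.snd
  have hE : Primrec fun t : (ℤ × ℕ) × (ℤ × ℤ × ℤ) × ℤ × ℕ × ℕ × ℕ => t.2.2.1 :=
    Primrec.fst.comp (Primrec.snd.comp Primrec.snd)
  have he : Primrec fun t : (ℤ × ℕ) × (ℤ × ℤ × ℤ) × ℤ × ℕ × ℕ × ℕ => t.2.2.2 :=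
    Primrec.snd.comp (Primrec.snd.comp Primrec.snd)
  have hi := Primrec.fst.comp he
  have hj := Primrec.fst.comp (Primrec.snd.comp he)
  have hk := Primrec.snd.comp (Primrec.snd.comp he)
  exact Primrec₂.int_mul.comp (Primrec.fst.comp Primrec.fst)
    (Primrec₂.int_mul.comp (Primrec₂.int_mul.comp (Primrec₂.int_mul.comp
      (zpow.comp (Primrec.fst.comp hx) hi)
      (zpow.comp (Primrec.fst.comp (Primrec.snd.comp hx)) hj))
      (zpow.comp (Primrec.snd.comp (Primrec.snd.comp hx)) hk))
      (zpow.comp hE (Primrec.nat_sub.comp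
        (Primrec.nat_mul.comp (Primrec.const 6) (Primrec.snd.comp Primrec.fst))
        (Primrec.nat_add.comp (Primrec.nat_add.comp hi hj) hk))))

theorem primrec_homogEval {α : Type*} [Primcodable α] {d : α → ℕ} {c : α → ℕ → ℕ → ℕ → ℤ}
    {x : α → ℤ × ℤ × ℤ} {E : α → ℤ} (hd : Primrec d)
    (hc : Primrec fun q : α × ℕ × ℕ × ℕ => c q.1 q.2.1 q.2.2.1 q.2.2.2)
    (hx : Primrec x) (hE : Primrec E) : Primrec fun a => homogEval (d a) (c a) (x a) (E a) := by
  have ha : Primrec fun t : ((α × ℕ) × ℕ) × ℕ => t.1.1.1 :=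
    Primrec.fst.comp (Primrec.fst.comp Primrec.fst)
  have he : Primrec fun t : ((α × ℕ) × ℕ) × ℕ => (t.1.1.2, t.1.2, t.2) :=
    (Primrec.snd.comp (Primrec.fst.comp Primrec.fst)).pair
      ((Primrec.snd.comp Primrec.fst).pair Primrec.snd)
  have hterm := primrec_homogEval_term.comp (((hc.comp (ha.pair he)).pair (hd.comp ha)).pair
    ((hx.comp ha).pair ((hE.comp ha).pair he)))
  have hd' := Primrec.succ.comp hd
  exact Primrec.finset_sum_range Primrec₂.int_add hd'
    (Primrec.finset_sum_range Primrec₂.int_add (hd'.comp Primrec.fst)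
      (Primrec.finset_sum_range Primrec₂.int_add (hd'.comp (Primrec.fst.comp Primrec.fst)) hterm))

theorem primrec_value : Primrec₂ value :=
  primrec_homogEval (primrec_degree.comp Primrec.fst)
    (primrec_coeff.comp ((Primrec.fst.comp Primrec.fst).pair Primrec.snd))
    primrec_orbit
    ((Primrec₂.monoid_pow Primrec₂.int_mul).comp
      (Primrec.int_natCast.comp (primrec_den.comp Primrec.fst)) (Primrec.succ.comp Primrec.snd))

theorem primrec_sizeBound : Primrec sizeBound :=
  Primrec.nat_add.comp
    (Primrec.list_sum_map primrec_entries (Primrec.nat_add.comp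
      (Primrec.succ.comp (Primrec.int_natAbs.comp Primrec.fst)) Primrec.snd))
    (Primrec.list_sum_map primrec_coeffs (Primrec.succ.comp Primrec.int_natAbs))

theorem primrec_testIndex : Primrec₂ testIndex := by
  have npow := Primrec₂.monoid_pow Primrec.nat_mul
  exact Primrec.nat_add.comp (Primrec.nat_mul.comp (Primrec.const 288)
    (npow.comp (Primrec.const 2) (npow.comp (primrec_sizeBound.comp Primrec.fst)
      (Primrec.const 6)))) Primrec.snd

theorem primrec_holds : PrimrecPred fun q : InstanceCode × ℕ => q.1.Holds q.2 := by
  have hv : Primrec fun q : InstanceCode × ℕ => q.1.value (q.1.testIndex q.2) :=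
    primrec_value.comp Primrec.fst primrec_testIndex
  have hb : Primrec fun q : InstanceCode × ℕ => q.1.2.2.2 :=
    Primrec.snd.comp (Primrec.snd.comp (Primrec.snd.comp Primrec.fst))
  exact (PrimrecPred.int_pos.comp hv).or
    ((Primrec.eq.comp hb (Primrec.const false)).and (PrimrecPred.int_nonneg.comp hv))

theorem primrec_residues : Primrec residues :=
  Primrec.listFilterMap (Primrec.const (List.range 288))
    (Primrec.ite primrec_holds (Primrec.option_some.comp Primrec.snd) (Primrec.const none))

end InstanceCode

/-! ### Correctness of the algorithm and the final bound. -/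

theorem List.length_flatMap_range {α : Type*} {b : ℕ} {f : ℕ → List α} (hf : ∀ i, (f i).length = b)
    (a : ℕ) : ((List.range a).flatMap f).length = a * b := by
  simp [List.length_flatMap, hf]

theorem List.getD_flatMap_range {α : Type*} {b : ℕ} {f : ℕ → List α} (hf : ∀ i, (f i).length = b)
    {a i j : ℕ} (hi : i < a) (hj : j < b) (z : α) :
    ((List.range a).flatMap f).getD (i * b + j) z = (f i).getD j z := by
  induction a with
  | zero => omega
  | succ a ih =>
    rw [List.range_succ, List.flatMap_append]
    rcases Nat.lt_succ_iff_lt_or_eq.mp hi with h | rfl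
    · rw [List.getD_append, ih h]
      rw [List.length_flatMap_range hf]
      calc i * b + j < (i + 1) * b := by rw [add_mul, one_mul]; omega
        _ ≤ a * b := Nat.mul_le_mul_right b h
    · rw [List.getD_append_right _ _ _ _ (by rw [List.length_flatMap_range hf]; omega),
        List.length_flatMap_range hf]
      simp

theorem getD_coeffList (p : MvPolynomial (Fin 3) ℤ) {i j k : ℕ} (hi : i ≤ p.totalDegree)
    (hj : j ≤ p.totalDegree) (hk : k ≤ p.totalDegree) :
    (coeffList p).getD ((i * (p.totalDegree + 1) + j) * (p.totalDegree + 1) + k) 0 =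
      coeff3 p i j k := by
  set b := p.totalDegree + 1 with hb
  have h1 : ∀ i j, ((List.range b).map fun k => coeff3 p i j k).length = b := fun i j => by simp
  have h2 := fun i => List.length_flatMap_range (h1 i) b
  have hjk : j * b + k < b * b := by
    calc j * b + k < (j + 1) * b := by rw [add_mul, one_mul]; omega
      _ ≤ b * b := Nat.mul_le_mul_right b (by omega)
  rw [show (i * b + j) * b + k = i * (b * b) + (j * b + k) by ring, coeffList,
    List.getD_flatMap_range h2 (by omega) hjk, List.getD_flatMap_range (h1 i) (by omega) (by omega)]
  rw [List.getD_eq_getElem _ _ (by simp; omega)]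
  simp

section

variable (M : Matrix (Fin 3) (Fin 3) ℚ) (s : Fin 3 → ℚ) (p : MvPolynomial (Fin 3) ℤ)
  (strict : Bool)

theorem instanceCode_entries :
    (instanceCode M s p strict).1 ++ (instanceCode M s p strict).2.1 =
      (entryList M s).map ratCode := rfl

theorem den_instanceCode : (instanceCode M s p strict).den = commonDen M s := by
  rw [InstanceCode.den, instanceCode_entries, List.map_map]
  rfl

theorem step_instanceCode (v : Fin 3 → ℤ) :
    (instanceCode M s p strict).step (v 0, v 1, v 2) =
      ((intMatrix M s).mulVec v 0, (intMatrix M s).mulVec v 1, (intMatrix M s).mulVec v 2) := by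
  simp only [Matrix.mulVec, dotProduct, Fin.sum_univ_three, InstanceCode.step,
    InstanceCode.matrixEntry, den_instanceCode]
  rfl

theorem orbit_instanceCode (n : ℕ) :
    (instanceCode M s p strict).orbit n =
      ((intMatrix M s ^ n).mulVec (intVector M s) 0, (intMatrix M s ^ n).mulVec (intVector M s) 1,
        (intMatrix M s ^ n).mulVec (intVector M s) 2) := by
  induction n with
  | zero =>
    simp only [InstanceCode.orbit, InstanceCode.vectorEntry, den_instanceCode, pow_zero,
      Matrix.one_mulVec]
    rfl
  | succ n ih =>
    rw [InstanceCode.orbit, Function.iterate_succ_apply', ← InstanceCode.orbit, ih,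
      step_instanceCode, Matrix.mulVec_mulVec, ← pow_succ']

theorem sign_value_instanceCode (n : ℕ) :
    SignType.sign ((instanceCode M s p strict).value n) =
      SignType.sign (MvPolynomial.aeval (fun i => (((M ^ n).mulVec s i : ℚ) : ℝ)) p) := by
  have hE : (commonDen M s : ℤ) ^ (n + 1) ≠ 0 :=
    pow_ne_zero _ (by exact_mod_cast (commonDen_pos M s).ne')
  have hvalue : (instanceCode M s p strict).value n = homogEval p.totalDegree (coeff3 p)
      ((instanceCode M s p strict).orbit n) ((commonDen M s : ℤ) ^ (n + 1)) := by
    rw [InstanceCode.value, den_instanceCode]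
    refine Finset.sum_congr rfl fun i hi => Finset.sum_congr rfl fun j hj =>
      Finset.sum_congr rfl fun k hk => ?_
    congr 1
    exact getD_coeffList p (Nat.lt_succ_iff.mp (Finset.mem_range.mp hi))
      (Nat.lt_succ_iff.mp (Finset.mem_range.mp hj)) (Nat.lt_succ_iff.mp (Finset.mem_range.mp hk))
  rw [hvalue]
  refine sign_homogEval p _ hE ?_ ?_ ?_ <;> rw [orbit_instanceCode] <;>
    exact intMatrix_pow_mulVec M s n _

theorem holds_instanceCode_iff (r : ℕ) :
    (instanceCode M s p strict).Holds r ↔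
      (fun i => (((M ^ (instanceCode M s p strict).testIndex r).mulVec s i : ℚ) : ℝ)) ∈
        atomicSet p strict := by
  rw [mem_atomicSet_iff_sign, ← sign_value_instanceCode M s p strict, sign_eq_one_iff,
    sign_eq_zero_iff, InstanceCode.Holds, le_iff_lt_or_eq, eq_comm (a := (0 : ℤ))]
  change _ ∨ (strict = false ∧ _) ↔ _
  tauto

/-- The algorithm replaces bit lengths by the numbers themselves. The overestimate only moves the
test index further out, which is harmless for computability. -/
theorem instanceSize_le_sizeBound :
    instanceSize M s p ≤ (instanceCode M s p strict).sizeBound := by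
  have hsize : ∀ n : ℕ, n.size ≤ n := fun n => Nat.size_le.mpr Nat.lt_two_pow_self
  have hint : ∀ z : ℤ, intBits z ≤ z.natAbs + 1 := fun z => Nat.succ_le_succ (hsize _)
  rw [InstanceCode.sizeBound, instanceCode_entries, instanceSize_eq, List.map_map]
  refine Nat.add_le_add (List.sum_le_sum fun q _ => ?_) (List.sum_le_sum fun z _ => hint z)
  exact Nat.add_le_add (hint q.num) (hsize q.den)

end

/-- The exponent 6 works because `25 ^ 4` exceeds 20881 with room for the other terms; `25 ^ 3` does
not. -/
theorem threshold_le {h : ℕ} (hh : 25 ≤ h) :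
    288 * (2 ^ (20881 * h ^ 2) + 1) ≤ 2 ^ h ^ 6 := by
  have h1 : 2 ^ (20881 * h ^ 2) + 1 ≤ 2 ^ (20881 * h ^ 2 + 1) := by
    rw [pow_succ 2]
    have : 1 ≤ 2 ^ (20881 * h ^ 2) := Nat.one_le_two_pow
    omega
  calc 288 * (2 ^ (20881 * h ^ 2) + 1) ≤ 2 ^ 9 * 2 ^ (20881 * h ^ 2 + 1) :=
        Nat.mul_le_mul (by norm_num) h1
    _ = 2 ^ (9 + (20881 * h ^ 2 + 1)) := by rw [pow_add 2 9]
    _ ≤ 2 ^ h ^ 6 := by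
        refine Nat.pow_le_pow_right two_pos ?_
        have h4 : 25 ^ 4 ≤ h ^ 4 := Nat.pow_le_pow_left hh 4
        have h2 : 25 ^ 2 ≤ h ^ 2 := Nat.pow_le_pow_left hh 2
        have : h ^ 6 = h ^ 4 * h ^ 2 := by ring
        nlinarith [Nat.mul_le_mul_right (h ^ 2) h4]

theorem theorem13 :
    ∃ (C : ℕ) (X : InstanceCode → List ℕ), Computable X ∧
      ∀ (M : Matrix (Fin 3) (Fin 3) ℚ) (s : Fin 3 → ℚ)
        (p : MvPolynomial (Fin 3) ℤ) (strict : Bool) (l : ℂ) (ρ : ℝ),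
        (M.map (fun q : ℚ => (q : ℂ))).charpoly.roots = {l, (starRingEnd ℂ) l, (ρ : ℂ)} →
        l.im ≠ 0 →
        (∃ d : ℕ, 0 < d ∧ (l / (‖l‖ : ℂ)) ^ d = 1) →
        (∀ r ∈ X (instanceCode M s p strict), r < 288) ∧
        ∃ N : ℕ, N ≤ 2 ^ (instanceSize M s p) ^ C ∧
          ∀ n : ℕ, N < n →
            ((fun i => (((M ^ n).mulVec s i : ℚ) : ℝ)) ∈ atomicSet p strict ↔
              n % 288 ∈ X (instanceCode M s p strict)) := by
  refine ⟨6, InstanceCode.residues, InstanceCode.primrec_residues.to_comp, ?_⟩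
  intro M s p strict l ρ hroots him hunity
  refine ⟨fun r hr => (InstanceCode.mem_residues.mp hr).1, ?_⟩
  have hsize := le_instanceSize M s p
  have hthr := threshold_le hsize
  -- The witness is `N = 288 * (2 ^ (20881 * h ^ 2) + 1)` with `h` the size, so that `n > N` puts `n
  -- / 288` beyond the threshold for `m`. The test index lies beyond it as well, so `n` and the test
  -- index of its class see the same sign.
  refine ⟨_, hthr, fun n hn => ?_⟩
  have hr : n % 288 < 288 := Nat.mod_lt _ (by norm_num)
  obtain ⟨σ, hσ⟩ := sign_eventually_const s p hroots him hunity hr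
  rw [InstanceCode.mem_residues, holds_instanceCode_iff, mem_atomicSet_iff_sign,
    mem_atomicSet_iff_sign, InstanceCode.testIndex, hσ]
  · have h1 := hσ (n / 288) (by
      have := Nat.div_add_mod n 288
      generalize 2 ^ (20881 * instanceSize M s p ^ 2) = N at *
      omega)
    rw [Nat.div_add_mod] at h1
    rw [h1, and_iff_right hr]
  · have h2 : 2 ^ instanceSize M s p ^ 6 ≤ 2 ^ (instanceCode M s p strict).sizeBound ^ 6 :=
      Nat.pow_le_pow_right two_pos
        (Nat.pow_le_pow_left (instanceSize_le_sizeBound M s p strict) 6)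
    refine lt_of_lt_of_le ?_ (hthr.trans h2)
    omega
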